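/- Let $\mathbb D=\{z\in\mathbb C:|z|\le 1\}$, $S^1=\mathbb R/2\pi\mathbb Z$ with coordinate $\theta$, let $ST^2=\mathbb D\times S^1\subset\mathbb C\times S^1$ be the solid torus with boundary $\mathbb T^2=\{|z|=1\}\times S^1$, and let $E=(\mathbb C\times S^1)\setminus ST^2$. Consider the Dirac operator $$D=\begin{pmatrix}\frac1i\frac{\partial}{\partial\theta} & 2\frac{\partial}{\partial\bar z}\\[2pt] -2\frac{\partial}{\partial z} & -\frac1i\frac{\partial}{\partial\theta}\end{pmatrix}$$ in the Hilbert space $L^2(ST^2,\mathbb C^2)$, whose domain $\mathrm{dom}(D)$ consists of those $F\in H^1(ST^2)\otimes\mathbb C^2$ for which there is $F^{ext}\in H^1_{loc}(E)\otimes\mathbb C^2$ such that 1. $F^{ext}|_{\mathbb T^2}=F|_{\mathbb T^2}$, 2. $DF^{ext}=0$ on $E$, 3. $F^{ext}\in L^2(E)\otimes\mathbb C^2$. Here $H^1$ is the first Sobolev space, derivatives are weak derivatives, $H^1_{loc}(E)$ means $H^1$ on $\{1<|z|<R\}\times S^1$ for every $R>1$, and the restrictions to $\mathbb T^2$ are Sobolev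 traces. Then the kernel of $D$ is trivial: $\{F\in\mathrm{dom}(D): DF=0\}=\{0\}$. -/

import Mathlib

open MeasureTheory Filter Topology
open scoped ContDiff

noncomputable section

namespace SolidTorusDirac

/-- The circle `S¹ = ℝ / 2πℤ`, with the angular coordinate `θ` and arc length `dθ`. -/
abbrev S1 : Type := AddCircle (2 * Real.pi)

instance : Fact (0 < 2 * Real.pi) := ⟨Real.two_pi_pos⟩

/-- The space `ℂ × S¹`; its volume is the product of planar Lebesgue measure and `dθ`. -/
abbrev Space : Type := ℂ × S1

/-- The value space `ℂ²`. -/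
abbrev C2 : Type := EuclideanSpace ℂ (Fin 2)

/-- The closed solid torus `{|z| ≤ 1} × S¹`. -/
def solidTorus : Set Space := {p | ‖p.1‖ ≤ 1}

/-- The interior `{|z| < 1} × S¹` of the solid torus. -/
def openSolidTorus : Set Space := {p | ‖p.1‖ < 1}

/-- The open exterior `(ℂ × S¹) \ solidTorus`. -/
def exterior : Set Space := {p | 1 < ‖p.1‖}

/-- The bounded part `{1 < |z| < R} × S¹` of the exterior. -/
def shell (R : ℝ) : Set Space := {p | 1 < ‖p.1‖ ∧ ‖p.1‖ < R}

/-- The boundary torus of the solid torus, parametrised by the two angles: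
`(φ, θ) ↦ (exp (i φ), θ)`. -/
def boundaryPoint (q : S1 × S1) : Space := ((AddCircle.toCircle q.1 : ℂ), q.2)

/-- Smooth functions on `ℂ × S¹`: the lift to `ℂ × ℝ` is smooth. -/
def IsSmooth (u : Space → ℂ) : Prop :=
  ContDiff ℝ ∞ (fun q : ℂ × ℝ => u (q.1, (q.2 : S1)))

/-- The coordinate directions `∂/∂x`, `∂/∂y` (where `z = x + i y`) and `∂/∂θ`. -/
def dir : Fin 3 → ℂ × ℝ := ![(1, 0), (Complex.I, 0), (0, 1)]

/-- The classical partial derivative of `u` in the coordinate direction `j`. -/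
def partialDeriv (j : Fin 3) (u : Space → ℂ) (p : Space) : ℂ :=
  deriv (fun s : ℝ => u (p.1 + s • (dir j).1, p.2 + ((s * (dir j).2 : ℝ) : S1))) 0

/-- `w` is the weak derivative of `u` on the open set `Ω` in the coordinate direction `j`. -/
def HasWeakDeriv (Ω : Set Space) (j : Fin 3) (u w : Space → ℂ) : Prop :=
  ∀ φ : Space → ℂ, IsSmooth φ → HasCompactSupport φ → tsupport φ ⊆ Ω →
    ∫ p in Ω, u p * partialDeriv j φ p = - ∫ p in Ω, w p * φ p

/-- `u` belongs to the Sobolev space `H¹(Ω)` and its weak gradient is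
`w = (∂u/∂x, ∂u/∂y, ∂u/∂θ)`. -/
def HasH1Gradient (Ω : Set Space) (u : Space → ℂ) (w : Fin 3 → Space → ℂ) : Prop :=
  MemLp u 2 (volume.restrict Ω) ∧
    ∀ j, MemLp (w j) 2 (volume.restrict Ω) ∧ HasWeakDeriv Ω j u (w j)

/-- `u` belongs to `H¹_loc` of the exterior (local at infinity, up to the boundary torus, so
that boundary values make sense) and its weak gradient is `w`. -/
def HasH1LocGradient (u : Space → ℂ) (w : Fin 3 → Space → ℂ) : Prop :=
  ∀ R : ℝ, 1 < R → HasH1Gradient (shell R) u w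

/-- `g ∈ L²` is the trace of `u ∈ H¹(Ω)` on the boundary torus: there are functions `v k`, smooth
on all of `ℂ × S¹`, which converge to `u` in `H¹(Ω)` and whose restrictions to the
boundary torus converge to `g` in `L²`. -/
def HasTrace (Ω : Set Space) (u : Space → ℂ) (g : S1 × S1 → ℂ) : Prop :=
  MemLp g 2 volume ∧
  ∃ w : Fin 3 → Space → ℂ, HasH1Gradient Ω u w ∧
  ∃ v : ℕ → Space → ℂ, (∀ k, IsSmooth (v k)) ∧
    Tendsto (fun k => eLpNorm (fun p => v k p - u p) 2 (volume.restrict Ω)) atTop (𝓝 0) ∧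
    (∀ j, Tendsto (fun k => eLpNorm (fun p => partialDeriv j (v k) p - w j p) 2
      (volume.restrict Ω)) atTop (𝓝 0)) ∧
    Tendsto (fun k => eLpNorm (fun q => v k (boundaryPoint q) - g q) 2 volume) atTop (𝓝 0)

/-- `∂/∂z = (∂/∂x - i ∂/∂y) / 2`, in terms of the gradient `w`. -/
def dz (w : Fin 3 → Space → ℂ) (p : Space) : ℂ := (w 0 p - Complex.I * w 1 p) / 2

/-- `∂/∂z̄ = (∂/∂x + i ∂/∂y) / 2`, in terms of the gradient `w`. -/
def dzbar (w : Fin 3 → Space → ℂ) (p : Space) : ℂ := (w 0 p + Complex.I * w 1 p) / 2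

/-- The differential expression
`D = ((1/i) ∂/∂θ, 2 ∂/∂z̄; -2 ∂/∂z, -(1/i) ∂/∂θ)`, applied to a `ℂ²`-valued function whose
`i`-th component has gradient `W i`. -/
def diracExpr (W : Fin 2 → Fin 3 → Space → ℂ) (p : Space) : C2 :=
  !₂[1 / Complex.I * W 0 2 p + 2 * dzbar (W 1) p,
     -2 * dz (W 0) p - 1 / Complex.I * W 1 2 p]

/-- The Hilbert space `L²(solidTorus, ℂ²)`. -/
abbrev Hilb : Type := Lp C2 2 ((volume : Measure Space).restrict solidTorus)

/-- `Fext` is an admissible extension of `F` to the exterior: it is in `H¹_loc`, its trace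
on the boundary torus is that of `F`, it solves `D Fext = 0`, and it is square integrable. -/
def IsAdmissibleExtension (F Fext : Space → C2) : Prop :=
  (∃ W : Fin 2 → Fin 3 → Space → ℂ,
    (∀ i, HasH1LocGradient (fun p => Fext p i) (W i)) ∧
    ∀ᵐ p ∂(volume.restrict exterior), diracExpr W p = 0) ∧
  (∀ i, ∃ g : S1 × S1 → ℂ,
    HasTrace openSolidTorus (fun p => F p i) g ∧ HasTrace (shell 2) (fun p => Fext p i) g) ∧
  MemLp Fext 2 (volume.restrict exterior)

/-- The domain of the Dirac operator: `F ∈ H¹(solidTorus) ⊗ ℂ²` that have an admissible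
extension to the exterior. -/
def diracDomain : Set Hilb :=
  {F | (∀ i, ∃ w, HasH1Gradient openSolidTorus (fun p => F p i) w) ∧
    ∃ Fext : Space → C2, IsAdmissibleExtension F Fext}

/-- The Dirac operator with the non-local boundary condition, given by its graph: the pairs
`(F, G)` with `F` in the domain and `G = D F`. -/
def diracGraph : Set (Hilb × Hilb) :=
  {P | P.1 ∈ diracDomain ∧ ∃ W : Fin 2 → Fin 3 → Space → ℂ,
    (∀ i, HasH1Gradient openSolidTorus (fun p => P.1 p i) (W i)) ∧
    ∀ᵐ p ∂(volume.restrict openSolidTorus), P.2 p = diracExpr W p}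

/-- The kernel of the Dirac operator. -/
def diracKernel : Set Hilb := {F | (F, (0 : Hilb)) ∈ diracGraph}

end SolidTorusDirac

end

/-! The exterior condition turns the boundary value problem into a problem on all of ℂ × S¹. Let U
be F inside the solid torus and its extension outside. U is square integrable, and because the two
traces agree, no boundary term appears when U is tested against derivatives of a test function: U is
a global weak solution of D U = 0 (`weakDirac_glue`). Such a solution vanishes
(`WeakDirac.ae_eq_zero`): Fourier series in θ and the Fourier transform in z turn the equation into
a 2 × 2 linear system at each frequency (n, ξ), whose determinant n² + 4π²|ξ|² is nonzero for almost
every ξ. Hence U = 0, and so F = 0.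

The gluing needs no exact Green formula. For smooth ψ the integral of a partial derivative over the
solid torus is bounded by the L¹ norm of ψ on the boundary
(`norm_integral_openSolidTorus_partialDeriv_le`), and for compactly supported ψ the integral over
the exterior is its negative. Applied to the smooth functions that approximate the inner and outer
traces, this bounds the sum of the two boundary terms by a quantity tending to 0
(`exists_gradients_glue`). Each trace comes with its own choice of weak gradient;
`HasWeakDeriv.setIntegral_mul_eq` shows that the choice does not matter. -/

noncomputable section

namespace SolidTorusDirac

/-! ### Smooth functions on ℂ × S¹ and their partial derivatives -/

/-- The lift of a function on `ℂ × S¹` to the covering space `ℂ × ℝ`. -/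
def lift (u : Space → ℂ) (q : ℂ × ℝ) : ℂ := u (q.1, (q.2 : S1))

/-- Smoothness is defined upstairs on ℂ × ℝ. This map brings it down: continuity can be checked on
lifts, and every point has a lift. -/
theorem isOpenQuotientMap_covering :
    IsOpenQuotientMap (fun q : ℂ × ℝ => ((q.1, (q.2 : S1)) : Space)) :=
  IsOpenQuotientMap.id.prodMap QuotientAddGroup.isOpenQuotientMap_mk

theorem continuous_of_lift {u : Space → ℂ} (h : Continuous (lift u)) : Continuous u :=
  isOpenQuotientMap_covering.isQuotientMap.continuous_iff.2 h

namespace IsSmooth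

variable {u v : Space → ℂ}

theorem contDiff_lift (hu : IsSmooth u) : ContDiff ℝ ∞ (lift u) := hu

protected theorem continuous (hu : IsSmooth u) : Continuous u :=
  continuous_of_lift hu.contDiff_lift.continuous

protected theorem mul (hu : IsSmooth u) (hv : IsSmooth v) : IsSmooth (fun p => u p * v p) :=
  ContDiff.mul hu hv

protected theorem sub (hu : IsSmooth u) (hv : IsSmooth v) : IsSmooth (fun p => u p - v p) :=
  ContDiff.sub hu hv

theorem differentiableAt_lift (hu : IsSmooth u) (q : ℂ × ℝ) : DifferentiableAt ℝ (lift u) q :=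
  hu.contDiff_lift.differentiable (by simp) q

theorem hasDerivAt_coe (hu : IsSmooth u) (j : Fin 3) (q : ℂ × ℝ) :
    HasDerivAt (fun s : ℝ => u (q.1 + s • (dir j).1, (q.2 : S1) + ((s * (dir j).2 : ℝ) : S1)))
      (fderiv ℝ (lift u) q (dir j)) 0 := by
  have h : HasDerivAt (fun s : ℝ => q + s • dir j) (dir j) 0 := by
    simpa using ((hasDerivAt_id (0 : ℝ)).smul_const (dir j)).const_add q
  have h2 : HasFDerivAt (lift u) (fderiv ℝ (lift u) q) (q + (0 : ℝ) • dir j) := by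
    simpa using (hu.differentiableAt_lift q).hasFDerivAt
  have h3 := h2.comp_hasDerivAt (0 : ℝ) h
  refine h3.congr_of_eventuallyEq (Eventually.of_forall fun s => ?_)
  simp [lift, Function.comp, smul_eq_mul]

theorem partialDeriv_coe (hu : IsSmooth u) (j : Fin 3) (q : ℂ × ℝ) :
    partialDeriv j u (q.1, (q.2 : S1)) = fderiv ℝ (lift u) q (dir j) :=
  (hu.hasDerivAt_coe j q).deriv

theorem hasDerivAt_partialDeriv (hu : IsSmooth u) (j : Fin 3) (p : Space) :
    HasDerivAt (fun s : ℝ => u (p.1 + s • (dir j).1, p.2 + ((s * (dir j).2 : ℝ) : S1)))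
      (partialDeriv j u p) 0 := by
  obtain ⟨q, rfl⟩ := isOpenQuotientMap_covering.surjective p
  exact (hu.partialDeriv_coe j q).symm ▸ hu.hasDerivAt_coe j q

theorem continuous_partialDeriv (hu : IsSmooth u) (j : Fin 3) : Continuous (partialDeriv j u) := by
  apply continuous_of_lift
  have : lift (partialDeriv j u) = fun q => fderiv ℝ (lift u) q (dir j) :=
    funext fun q => hu.partialDeriv_coe j q
  rw [this]
  exact (hu.contDiff_lift.continuous_fderiv (by simp)).clm_apply continuous_const

theorem partialDeriv_mul (hu : IsSmooth u) (hv : IsSmooth v) (j : Fin 3) (p : Space) :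
    partialDeriv j (fun p => u p * v p) p = partialDeriv j u p * v p + u p * partialDeriv j v p := by
  refine ((hu.hasDerivAt_partialDeriv j p).mul (hv.hasDerivAt_partialDeriv j p)).deriv.trans ?_
  simp

theorem partialDeriv_sub (hu : IsSmooth u) (hv : IsSmooth v) (j : Fin 3) (p : Space) :
    partialDeriv j (fun p => u p - v p) p = partialDeriv j u p - partialDeriv j v p :=
  ((hu.hasDerivAt_partialDeriv j p).sub (hv.hasDerivAt_partialDeriv j p)).deriv

end IsSmooth

theorem partialDeriv_eq_zero_of_notMem_tsupport {u : Space → ℂ} (j : Fin 3) {p : Space}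
    (hp : p ∉ tsupport u) : partialDeriv j u p = 0 := by
  have h : u =ᶠ[𝓝 p] 0 := notMem_tsupport_iff_eventuallyEq.1 hp
  have hc : Tendsto (fun s : ℝ => ((p.1 + s • (dir j).1, p.2 + ((s * (dir j).2 : ℝ) : S1)) : Space))
      (𝓝 0) (𝓝 p) := by
    have : Continuous
        (fun s : ℝ => ((p.1 + s • (dir j).1, p.2 + ((s * (dir j).2 : ℝ) : S1)) : Space)) := by
      have := AddCircle.continuous_mk' (2 * Real.pi)
      fun_prop
    simpa using this.tendsto 0
  have h2 := hc.eventually h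
  unfold partialDeriv
  rw [EventuallyEq.deriv_eq (f := fun _ => (0 : ℂ)) h2]
  simp

/-! ### Product test functions with a single mode in θ -/

/-- The test function `f(z) exp(i n θ)`. -/
def prodTest (f : ℂ → ℂ) (n : ℤ) (p : Space) : ℂ := f p.1 * fourier n p.2

/-- The coefficient in front of `exp(i n θ)` in the `j`-th partial derivative of
`f(z) exp(i n θ)`. -/
def slotDeriv (j : Fin 3) (f : ℂ → ℂ) (n : ℤ) : ℂ → ℂ :=
  ![fun z => fderiv ℝ f z 1, fun z => fderiv ℝ f z Complex.I, fun z => Complex.I * n * f z] j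

section prodTest

variable {f : ℂ → ℂ} {n : ℤ}

theorem fourier_coe_two_pi (n : ℤ) (t : ℝ) :
    fourier n (t : S1) = Complex.exp (Complex.I * n * t) := by
  rw [fourier_coe_apply]
  congr 1
  have : (Real.pi : ℂ) ≠ 0 := by exact_mod_cast Real.pi_ne_zero
  push_cast
  field_simp

theorem isSmooth_prodTest (hf : ContDiff ℝ ∞ f) : IsSmooth (prodTest f n) := by
  have h : ContDiff ℝ ∞ (fun q : ℂ × ℝ => f q.1 * Complex.exp (Complex.I * n * q.2)) := by
    refine (hf.comp contDiff_fst).mul (ContDiff.cexp (contDiff_const.mul ?_))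
    exact Complex.ofRealCLM.contDiff.comp contDiff_snd
  unfold IsSmooth prodTest
  simpa only [fourier_coe_two_pi] using h

theorem tsupport_prodTest_subset : tsupport (prodTest f n) ⊆ tsupport f ×ˢ Set.univ := by
  refine closure_minimal (fun p hp => ?_) ((isClosed_tsupport f).prod isClosed_univ)
  exact ⟨subset_tsupport _ (left_ne_zero_of_mul hp), trivial⟩

theorem hasCompactSupport_prodTest (hf : HasCompactSupport f) :
    HasCompactSupport (prodTest f n) :=
  IsCompact.of_isClosed_subset (hf.isCompact.prod isCompact_univ) (isClosed_tsupport _)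
    tsupport_prodTest_subset

theorem partialDeriv_prodTest (hf : ContDiff ℝ ∞ f) (j : Fin 3) :
    partialDeriv j (prodTest f n) = prodTest (slotDeriv j f n) n := by
  funext p
  obtain ⟨⟨z, t⟩, rfl⟩ := isOpenQuotientMap_covering.surjective p
  rw [(isSmooth_prodTest hf).partialDeriv_coe j (z, t)]
  have hl : lift (prodTest f n) = fun q : ℂ × ℝ => f q.1 * Complex.exp (Complex.I * n * q.2) := by
    funext q
    simp only [lift, prodTest, fourier_coe_two_pi]
  have h1 : HasFDerivAt (fun q : ℂ × ℝ => f q.1)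
      ((fderiv ℝ f z).comp (ContinuousLinearMap.fst ℝ ℂ ℝ)) (z, t) :=
    HasFDerivAt.comp (z, t) (g := f) (f := Prod.fst)
      ((hf.differentiable (by simp)) z).hasFDerivAt hasFDerivAt_fst
  have h2 : HasFDerivAt (fun q : ℂ × ℝ => Complex.I * n * (q.2 : ℂ))
      ((Complex.I * n) • (Complex.ofRealCLM.comp (ContinuousLinearMap.snd ℝ ℂ ℝ))) (z, t) :=
    (HasFDerivAt.comp (z, t) (g := fun s : ℝ => (s : ℂ)) (f := Prod.snd)
      Complex.ofRealCLM.hasFDerivAt hasFDerivAt_snd).const_mul _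
  have h3 : HasFDerivAt (fun q : ℂ × ℝ => f q.1 * Complex.exp (Complex.I * n * q.2)) _ (z, t) :=
    h1.mul h2.cexp
  rw [hl, h3.fderiv]
  fin_cases j <;> simp [dir, prodTest, slotDeriv, -fourier_apply, fourier_coe_two_pi] <;> ring

theorem contDiff_slotDeriv (hf : ContDiff ℝ ∞ f) (j : Fin 3) : ContDiff ℝ ∞ (slotDeriv j f n) := by
  have h : ContDiff ℝ ∞ (fderiv ℝ f) := hf.fderiv_right (by simp)
  fin_cases j
  · exact h.clm_apply contDiff_const
  · exact h.clm_apply contDiff_const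
  · exact contDiff_const.mul hf

theorem hasCompactSupport_slotDeriv (hf : HasCompactSupport f) (j : Fin 3) :
    HasCompactSupport (slotDeriv j f n) := by
  fin_cases j
  · exact hf.fderiv_apply (𝕜 := ℝ) 1
  · exact hf.fderiv_apply (𝕜 := ℝ) Complex.I
  · exact HasCompactSupport.mul_left hf

end prodTest

/-! ### Boundary estimate on the unit disc -/

theorem mem_ball_iff_mem_Ioo (x y : ℝ) :
    (x + y * Complex.I : ℂ) ∈ Metric.ball (0 : ℂ) 1 ↔
      x ∈ Set.Ioo (-√(1 - y ^ 2)) √(1 - y ^ 2) := by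
  rw [mem_ball_zero_iff, Complex.norm_add_mul_I, Set.mem_Ioo, ← abs_lt, Real.lt_sqrt (abs_nonneg x),
    sq_abs, Real.sqrt_lt' one_pos]
  constructor <;> intro h <;> linarith

theorem integral_eq_integral_integral_complex {F : ℂ → ℂ} (hF : Integrable F) :
    ∫ z, F z = ∫ y : ℝ, ∫ x : ℝ, F (x + y * Complex.I) := by
  have hmp := Complex.volume_preserving_equiv_real_prod.symm
  have hsymm : ∀ p : ℝ × ℝ, Complex.measurableEquivRealProd.symm p = p.1 + p.2 * Complex.I :=
    fun p => Complex.mk_eq_add_mul_I p.1 p.2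
  rw [← hmp.integral_comp Complex.measurableEquivRealProd.symm.measurableEmbedding]
  have hI : Integrable (fun p => F (Complex.measurableEquivRealProd.symm p))
      ((volume : Measure ℝ).prod volume) := hmp.integrable_comp_of_integrable hF
  rw [Measure.volume_eq_prod, integral_prod_symm _ hI]
  simp only [hsymm]

/-- Fubini, and the fundamental theorem of calculus on each horizontal chord of the disc. -/
theorem integral_ball_fderiv_one {g : ℂ → ℂ} (hg : ContDiff ℝ 1 g) :
    ∫ z in Metric.ball (0 : ℂ) 1, fderiv ℝ g z 1 =
      ∫ y in (-1 : ℝ)..1, (g (√(1 - y ^ 2) + y * Complex.I) -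
        g (((-√(1 - y ^ 2) : ℝ) : ℂ) + y * Complex.I)) := by
  have hc : Continuous (fun z => fderiv ℝ g z 1) :=
    (hg.continuous_fderiv one_ne_zero).clm_apply continuous_const
  have hint : IntegrableOn (fun z => fderiv ℝ g z 1) (Metric.ball (0 : ℂ) 1) :=
    (hc.continuousOn.integrableOn_compact (isCompact_closedBall 0 1)).mono_set
      Metric.ball_subset_closedBall
  rw [← integral_indicator Metric.isOpen_ball.measurableSet,
    integral_eq_integral_integral_complex (hint.integrable_indicator
      Metric.isOpen_ball.measurableSet)]
  have inner : ∀ y : ℝ, ∫ x : ℝ, (Metric.ball (0 : ℂ) 1).indicator (fun z => fderiv ℝ g z 1)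
      (x + y * Complex.I) = g (√(1 - y ^ 2) + y * Complex.I) -
        g (((-√(1 - y ^ 2) : ℝ) : ℂ) + y * Complex.I) := by
    intro y
    have h1 : (fun x : ℝ => (Metric.ball (0 : ℂ) 1).indicator (fun z => fderiv ℝ g z 1)
        (x + y * Complex.I)) = (Set.Ioo (-√(1 - y ^ 2)) √(1 - y ^ 2)).indicator
          (fun x : ℝ => fderiv ℝ g (x + y * Complex.I) 1) := by
      funext x
      by_cases hx : x ∈ Set.Ioo (-√(1 - y ^ 2)) √(1 - y ^ 2)
      · rw [Set.indicator_of_mem hx, Set.indicator_of_mem ((mem_ball_iff_mem_Ioo x y).2 hx)]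
      · rw [Set.indicator_of_notMem hx,
          Set.indicator_of_notMem (fun h => hx ((mem_ball_iff_mem_Ioo x y).1 h))]
    rw [h1, integral_indicator measurableSet_Ioo, ← integral_Ioc_eq_integral_Ioo,
      ← intervalIntegral.integral_of_le (by linarith [Real.sqrt_nonneg (1 - y ^ 2)])]
    refine intervalIntegral.integral_eq_sub_of_hasDerivAt (f := fun x : ℝ => g (x + y * Complex.I))
      (fun x _ => ?_) ?_
    · have hl : HasDerivAt (fun x : ℝ => (x + y * Complex.I : ℂ)) 1 x :=
        (Complex.ofRealCLM.hasDerivAt (x := x)).add_const _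
      exact ((hg.differentiable one_ne_zero) _).hasFDerivAt.comp_hasDerivAt x hl
    · exact (hc.comp (by fun_prop)).intervalIntegrable _ _
  simp only [inner]
  -- For |y| ≥ 1 the real square root takes the value 0, so both endpoints coincide and the
  -- difference vanishes.
  rw [intervalIntegral.integral_of_le (by norm_num), setIntegral_eq_integral_of_forall_compl_eq_zero]
  intro y hy
  have : 1 - y ^ 2 ≤ 0 := by
    by_contra hlt
    have : |y| < 1 := by rw [← sq_lt_one_iff_abs_lt_one]; linarith
    exact hy ⟨(abs_lt.1 this).1, (abs_lt.1 this).2.le⟩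
  simp [Real.sqrt_eq_zero_of_nonpos this]

/-- The left half circle is reparametrised by t ↦ π - t, so that both halves are graphs over the
same height sin t, like the endpoints of a horizontal chord. -/
theorem integral_circle_eq_integral_halves {h : ℂ → ℝ} (hh : Continuous h) :
    ∫ q : S1, h (AddCircle.toCircle q) =
      (∫ t in (-(Real.pi / 2))..(Real.pi / 2), h (Real.cos t + Real.sin t * Complex.I)) +
      ∫ t in (-(Real.pi / 2))..(Real.pi / 2),
        h (((-Real.cos t : ℝ) : ℂ) + Real.sin t * Complex.I) := by
  have hcirc : ∀ t : ℝ, ((AddCircle.toCircle (t : S1) : Circle) : ℂ) =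
      Real.cos t + Real.sin t * Complex.I := by
    intro t
    rw [← fourier_one, fourier_coe_two_pi]
    rw [Complex.ofReal_cos, Complex.ofReal_sin, ← Complex.exp_mul_I]
    congr 1
    push_cast
    ring
  rw [← AddCircle.intervalIntegral_preimage _ (-(Real.pi / 2))]
  have hint : ∀ a b : ℝ, IntervalIntegrable
      (fun t : ℝ => h (Real.cos t + Real.sin t * Complex.I)) volume a b := fun a b =>
    (hh.comp (by fun_prop)).intervalIntegrable _ _
  simp only [hcirc]
  rw [← intervalIntegral.integral_add_adjacent_intervals (hint _ (Real.pi / 2)) (hint _ _)]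
  congr 1
  have := intervalIntegral.integral_comp_sub_left (a := -(Real.pi / 2)) (b := Real.pi / 2)
    (fun t : ℝ => h (Real.cos t + Real.sin t * Complex.I)) Real.pi
  rw [show Real.pi - Real.pi / 2 = Real.pi / 2 by ring,
    show Real.pi - -(Real.pi / 2) = -(Real.pi / 2) + 2 * Real.pi by ring] at this
  rw [← this]
  simp only [Real.cos_pi_sub, Real.sin_pi_sub]

/-- Substituting y = sin t in the chord formula makes the chord endpoints the two circle points at
angles t and π - t. The Jacobian cos t is at most 1, and the triangle inequality separates the
endpoints. -/
theorem norm_integral_ball_fderiv_one_le {g : ℂ → ℂ} (hg : ContDiff ℝ 1 g) :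
    ‖∫ z in Metric.ball (0 : ℂ) 1, fderiv ℝ g z 1‖ ≤ ∫ q : S1, ‖g (AddCircle.toCircle q)‖ := by
  have hgc := hg.continuous
  rw [integral_ball_fderiv_one hg, integral_circle_eq_integral_halves hgc.norm]
  set G : ℝ → ℂ := fun y => g (√(1 - y ^ 2) + y * Complex.I) -
        g (((-√(1 - y ^ 2) : ℝ) : ℂ) + y * Complex.I) with hG
  have hGc : Continuous G := by
    rw [hG]; fun_prop
  have hpi : -(Real.pi / 2) ≤ Real.pi / 2 := by linarith [Real.pi_pos]
  refine (intervalIntegral.norm_integral_le_integral_norm (by norm_num)).trans ?_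
  have hsub := intervalIntegral.integral_comp_mul_deriv (a := -(Real.pi / 2)) (b := Real.pi / 2)
    (f := Real.sin) (f' := Real.cos) (g := fun y => ‖G y‖)
    (fun x _ => Real.hasDerivAt_sin x) Real.continuous_cos.continuousOn hGc.norm
  rw [Real.sin_neg, Real.sin_pi_div_two] at hsub
  rw [← hsub, ← intervalIntegral.integral_add]
  · refine intervalIntegral.integral_mono_on hpi ?_ ?_ fun t ht => ?_
    · exact Continuous.intervalIntegrable (by simp only [Function.comp_def]; fun_prop) _ _
    · exact Continuous.intervalIntegrable (by fun_prop) _ _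
    · have hcos : 0 ≤ Real.cos t := Real.cos_nonneg_of_mem_Icc ht
      have hs : √(1 - Real.sin t ^ 2) = Real.cos t := by
        rw [← Real.cos_sq', Real.sqrt_sq hcos]
      calc ‖G (Real.sin t)‖ * Real.cos t ≤ ‖G (Real.sin t)‖ * 1 :=
            mul_le_mul_of_nonneg_left (Real.cos_le_one t) (norm_nonneg _)
        _ ≤ _ := by
            rw [mul_one, hG]
            simp only [hs]
            exact norm_sub_le _ _
  · exact Continuous.intervalIntegrable (by fun_prop) _ _
  · exact Continuous.intervalIntegrable (by fun_prop) _ _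

/-- A quarter turn carries ∂/∂x to ∂/∂y and preserves both the disc and arc length, so the previous
estimate applies to z ↦ g(iz). -/
theorem norm_integral_ball_fderiv_I_le {g : ℂ → ℂ} (hg : ContDiff ℝ 1 g) :
    ‖∫ z in Metric.ball (0 : ℂ) 1, fderiv ℝ g z Complex.I‖ ≤
      ∫ q : S1, ‖g (AddCircle.toCircle q)‖ := by
  have hgI : ContDiff ℝ 1 (fun z => g (Complex.I * z)) := hg.comp (contDiff_const.mul contDiff_id)
  have h := norm_integral_ball_fderiv_one_le hgI
  have hd : ∀ z, fderiv ℝ (fun z => g (Complex.I * z)) z 1 =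
      fderiv ℝ g (Complex.I * z) Complex.I := by
    intro z
    have h1 : HasFDerivAt (fun z : ℂ => Complex.I * z)
        (Complex.I • ContinuousLinearMap.id ℝ ℂ) z := (hasFDerivAt_id z).const_mul Complex.I
    have h2 := ((hg.differentiable one_ne_zero) (Complex.I * z)).hasFDerivAt.comp z h1
    rw [show (fun z => g (Complex.I * z)) = g ∘ fun z => Complex.I * z from rfl, h2.fderiv]
    simp
  have hmp : MeasurePreserving (fun z : ℂ => Complex.I * z) := by
    have := (rotation (⟨Complex.I, by simp [Submonoid.unitSphere]⟩ : Circle)).measurePreserving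
    exact this
  have hemb : MeasurableEmbedding (fun z : ℂ => Complex.I * z) :=
    (Homeomorph.mulLeft₀ Complex.I Complex.I_ne_zero).measurableEmbedding
  have hL : ∫ z in Metric.ball (0 : ℂ) 1, fderiv ℝ (fun z => g (Complex.I * z)) z 1 =
      ∫ z in Metric.ball (0 : ℂ) 1, fderiv ℝ g z Complex.I := by
    rw [← hmp.setIntegral_preimage_emb hemb (fun z => fderiv ℝ g z Complex.I)]
    simp only [hd]
    congr 2
    ext z
    simp
  have hR : ∫ q : S1, ‖g (Complex.I * AddCircle.toCircle q)‖ =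
      ∫ q : S1, ‖g (AddCircle.toCircle q)‖ := by
    rw [← integral_add_left_eq_self (fun q : S1 => ‖g (AddCircle.toCircle q)‖) ((Real.pi / 2 : ℝ) : S1)]
    refine integral_congr_ae (Eventually.of_forall fun q => ?_)
    simp only [AddCircle.toCircle_add, Circle.coe_mul]
    congr 3
    rw [← fourier_one, fourier_coe_two_pi]
    rw [show Complex.I * ((1 : ℤ) : ℂ) * ((Real.pi / 2 : ℝ) : ℂ) = Real.pi / 2 * Complex.I by
      push_cast; ring, Complex.exp_pi_div_two_mul_I]
  rw [hL, hR] at h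
  exact h

/-! ### Integrals of partial derivatives over the solid torus and its exterior -/

theorem openSolidTorus_eq : openSolidTorus = Metric.ball (0 : ℂ) 1 ×ˢ Set.univ := by
  ext p; simp [openSolidTorus]

theorem isOpen_openSolidTorus : IsOpen openSolidTorus :=
  isOpen_lt (by fun_prop) continuous_const

theorem isOpen_exterior : IsOpen exterior :=
  isOpen_lt continuous_const (by fun_prop)

theorem isOpen_shell (R : ℝ) : IsOpen (shell R) :=
  isOpen_exterior.inter (isOpen_lt continuous_fst.norm continuous_const)

namespace IsSmooth

variable {u : Space → ℂ}

theorem contDiff_slice (hu : IsSmooth u) (θ : S1) : ContDiff ℝ ∞ (fun z => u (z, θ)) := by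
  obtain ⟨t, rfl⟩ := QuotientAddGroup.mk_surjective θ
  exact hu.contDiff_lift.comp (contDiff_id.prodMk contDiff_const)

theorem partialDeriv_zero (hu : IsSmooth u) (z : ℂ) (θ : S1) :
    partialDeriv 0 u (z, θ) = fderiv ℝ (fun z => u (z, θ)) z 1 := by
  rw [← ((hu.contDiff_slice θ).differentiable (by simp) z).lineDeriv_eq_fderiv]
  simp [partialDeriv, dir, lineDeriv]

theorem partialDeriv_one (hu : IsSmooth u) (z : ℂ) (θ : S1) :
    partialDeriv 1 u (z, θ) = fderiv ℝ (fun z => u (z, θ)) z Complex.I := by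
  rw [← ((hu.contDiff_slice θ).differentiable (by simp) z).lineDeriv_eq_fderiv]
  simp [partialDeriv, dir, lineDeriv]

theorem integral_partialDeriv_two (hu : IsSmooth u) (z : ℂ) :
    ∫ θ : S1, partialDeriv 2 u (z, θ) = 0 := by
  rw [← AddCircle.intervalIntegral_preimage _ 0]
  have hd : ∀ t : ℝ, HasDerivAt (fun t : ℝ => u (z, (t : S1))) (partialDeriv 2 u (z, (t : S1))) t := by
    intro t
    have h := hu.hasDerivAt_partialDeriv 2 (z, (t : S1))
    have h2 : HasDerivAt (fun s : ℝ => u (z, ((t + s : ℝ) : S1)))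
        (partialDeriv 2 u (z, (t : S1))) 0 := by simpa [dir] using h
    have h3 := HasDerivAt.comp_sub_const t t (f := fun s : ℝ => u (z, ((t + s : ℝ) : S1)))
      (f' := partialDeriv 2 u (z, (t : S1))) (by simpa using h2)
    simpa using h3
  have hc : Continuous (fun t : ℝ => partialDeriv 2 u (z, (t : S1))) :=
    (hu.continuous_partialDeriv 2).comp
      (continuous_const.prodMk (AddCircle.continuous_mk' _))
  rw [intervalIntegral.integral_eq_sub_of_hasDerivAt (fun t _ => hd t) (hc.intervalIntegrable _ _)]
  rw [zero_add, AddCircle.coe_period, QuotientAddGroup.mk_zero, sub_self]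

end IsSmooth

section Fubini

variable {A : Set ℂ} {F : Space → ℂ}

theorem setIntegral_prod_univ (hF : IntegrableOn F (A ×ˢ Set.univ)) :
    ∫ p in A ×ˢ Set.univ, F p = ∫ z in A, ∫ θ : S1, F (z, θ) := by
  rw [Measure.volume_eq_prod] at hF ⊢
  rw [setIntegral_prod F hF, Measure.restrict_univ]

theorem setIntegral_prod_univ_symm (hF : IntegrableOn F (A ×ˢ Set.univ)) :
    ∫ p in A ×ˢ Set.univ, F p = ∫ θ : S1, ∫ z in A, F (z, θ) := by
  rw [IntegrableOn, Measure.volume_eq_prod, ← Measure.prod_restrict, Measure.restrict_univ] at hF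
  rw [Measure.volume_eq_prod, ← Measure.prod_restrict, Measure.restrict_univ]
  exact integral_prod_symm F hF

end Fubini

theorem integral_fderiv_apply_eq_zero {g : ℂ → ℂ} (hg : ContDiff ℝ 1 g) (hs : HasCompactSupport g)
    (v : ℂ) : ∫ z, fderiv ℝ g z v = 0 := by
  have hc : Continuous (fun z => fderiv ℝ g z v) :=
    (hg.continuous_fderiv one_ne_zero).clm_apply continuous_const
  have h := integral_mul_fderiv_eq_neg_fderiv_mul_of_integrable (μ := (volume : Measure ℂ))
    (𝕜 := ℂ) (f := fun _ => (1 : ℂ)) (g := g) (v := v) (by simp)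
    (by simpa using hc.integrable_of_hasCompactSupport (hs.fderiv_apply (𝕜 := ℝ) v))
    (by simpa using hg.continuous.integrable_of_hasCompactSupport hs)
    (fun _ _ => differentiableAt_const _) (fun x _ => hg.differentiable one_ne_zero x)
  simpa using h

theorem hasCompactSupport_partialDeriv {ψ : Space → ℂ} (hs : HasCompactSupport ψ) (j : Fin 3) :
    HasCompactSupport (partialDeriv j ψ) :=
  hs.mono' fun p hp => by
    by_contra h
    exact hp (partialDeriv_eq_zero_of_notMem_tsupport j h)

theorem hasCompactSupport_slice {ψ : Space → ℂ} (hs : HasCompactSupport ψ) (θ : S1) :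
    HasCompactSupport (fun z => ψ (z, θ)) := by
  refine HasCompactSupport.intro (hs.isCompact.image continuous_fst) fun z hz => ?_
  by_contra h
  exact hz ⟨(z, θ), subset_tsupport _ h, rfl⟩

theorem integral_partialDeriv_eq_zero {ψ : Space → ℂ} (hψ : IsSmooth ψ) (hs : HasCompactSupport ψ)
    (j : Fin 3) : ∫ p, partialDeriv j ψ p = 0 := by
  have hint : IntegrableOn (partialDeriv j ψ) (Set.univ ×ˢ Set.univ) :=
    ((hψ.continuous_partialDeriv j).integrable_of_hasCompactSupport
      (hasCompactSupport_partialDeriv hs j)).integrableOn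
  have h0 : ∀ θ v, ∫ z, fderiv ℝ (fun z => ψ (z, θ)) z v = 0 := fun θ v =>
    integral_fderiv_apply_eq_zero ((hψ.contDiff_slice θ).of_le (by simp))
      (hasCompactSupport_slice hs θ) v
  rw [← setIntegral_univ, ← Set.univ_prod_univ]
  fin_cases j
  · rw [setIntegral_prod_univ_symm hint]
    simp [hψ.partialDeriv_zero, h0]
  · rw [setIntegral_prod_univ_symm hint]
    simp [hψ.partialDeriv_one, h0]
  · rw [setIntegral_prod_univ hint]
    simp [hψ.integral_partialDeriv_two]

theorem continuous_boundaryPoint : Continuous boundaryPoint :=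
  (continuous_subtype_val.comp (AddCircle.continuous_toCircle.comp continuous_fst)).prodMk
    continuous_snd

/-- A substitute for the divergence theorem: a bound by boundary values is enough, since it is
applied only to functions whose boundary values tend to 0. In the directions x and y it is the disc
estimate on each slice; in the direction θ the integral vanishes by periodicity. -/
theorem norm_integral_openSolidTorus_partialDeriv_le {ψ : Space → ℂ} (hψ : IsSmooth ψ)
    (j : Fin 3) :
    ‖∫ p in openSolidTorus, partialDeriv j ψ p‖ ≤ ∫ q, ‖ψ (boundaryPoint q)‖ := by
  have hint : IntegrableOn (partialDeriv j ψ) (Metric.ball (0 : ℂ) 1 ×ˢ Set.univ) :=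
    ((hψ.continuous_partialDeriv j).continuousOn.integrableOn_compact
      ((isCompact_closedBall (0 : ℂ) 1).prod isCompact_univ)).mono_set
        (Set.prod_mono Metric.ball_subset_closedBall subset_rfl)
  have hbc : Continuous (fun q => ‖ψ (boundaryPoint q)‖) :=
    (hψ.continuous.comp continuous_boundaryPoint).norm
  have hbi : Integrable (fun q => ‖ψ (boundaryPoint q)‖) ((volume : Measure S1).prod volume) :=
    hbc.integrable_of_hasCompactSupport (HasCompactSupport.of_compactSpace _)
  have key : ∀ F : S1 → ℂ, (∀ θ, ‖F θ‖ ≤ ∫ q : S1, ‖ψ (AddCircle.toCircle q, θ)‖) →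
      ‖∫ θ, F θ‖ ≤ ∫ q, ‖ψ (boundaryPoint q)‖ := by
    intro F hF
    rw [Measure.volume_eq_prod, integral_prod_symm _ hbi]
    exact norm_integral_le_of_norm_le hbi.integral_prod_right (Eventually.of_forall hF)
  have hsm : ∀ θ, ContDiff ℝ 1 (fun z => ψ (z, θ)) := fun θ => (hψ.contDiff_slice θ).of_le (by simp)
  rw [openSolidTorus_eq]
  fin_cases j
  · rw [setIntegral_prod_univ_symm hint]
    refine key _ fun θ => ?_
    simpa [hψ.partialDeriv_zero] using norm_integral_ball_fderiv_one_le (hsm θ)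
  · rw [setIntegral_prod_univ_symm hint]
    refine key _ fun θ => ?_
    simpa [hψ.partialDeriv_one] using norm_integral_ball_fderiv_I_le (hsm θ)
  · rw [setIntegral_prod_univ hint]
    simp only [Fin.reduceFinMk, hψ.integral_partialDeriv_two]
    simpa using integral_nonneg fun q => norm_nonneg _

theorem volume_boundary : volume {p : Space | ‖p.1‖ = 1} = 0 := by
  have : {p : Space | ‖p.1‖ = 1} = Metric.sphere (0 : ℂ) 1 ×ˢ Set.univ := by ext p; simp
  rw [this, Measure.volume_eq_prod, Measure.prod_prod, Measure.addHaar_sphere, zero_mul]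

theorem ae_norm_ne_one : ∀ᵐ p : Space, ‖p.1‖ ≠ 1 := by
  rw [ae_iff]
  simpa using volume_boundary

theorem integral_eq_add_exterior {F : Space → ℂ} (hF : Integrable F) :
    ∫ p, F p = (∫ p in openSolidTorus, F p) + ∫ p in exterior, F p := by
  rw [← setIntegral_union _ isOpen_exterior.measurableSet hF.integrableOn hF.integrableOn,
    ← setIntegral_univ]
  · refine setIntegral_congr_set ?_
    filter_upwards [ae_norm_ne_one] with p hp
    refine propext ⟨fun _ => ?_, fun _ => trivial⟩
    exact lt_or_gt_of_ne hp
  · exact Set.disjoint_left.2 fun p (hp : ‖p.1‖ < 1) (hq : 1 < ‖p.1‖) => lt_asymm hp hq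

theorem setIntegral_shell_eq {F : Space → ℂ} {R : ℝ} (hF : ∀ p : Space, R ≤ ‖p.1‖ → F p = 0) :
    ∫ p in shell R, F p = ∫ p in exterior, F p := by
  refine Eq.symm <| setIntegral_eq_of_subset_of_forall_sdiff_eq_zero isOpen_exterior.measurableSet
    (fun p hp => hp.1) fun p hp => hF p ?_
  by_contra h
  exact hp.2 ⟨hp.1, not_le.1 h⟩

/-- The integral over the whole space is 0 and the boundary torus is a null set. Thus the outside
needs no boundary estimate of its own. -/
theorem setIntegral_shell_partialDeriv {ψ : Space → ℂ} (hψ : IsSmooth ψ)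
    (hs : HasCompactSupport ψ) {R : ℝ} (hR : tsupport ψ ⊆ {p | ‖p.1‖ < R}) (j : Fin 3) :
    ∫ p in shell R, partialDeriv j ψ p = -∫ p in openSolidTorus, partialDeriv j ψ p := by
  have hint := (hψ.continuous_partialDeriv j).integrable_of_hasCompactSupport
      (hasCompactSupport_partialDeriv hs j) (μ := volume)
  have h := integral_eq_add_exterior hint
  rw [integral_partialDeriv_eq_zero hψ hs] at h
  rw [setIntegral_shell_eq fun p hp => partialDeriv_eq_zero_of_notMem_tsupport j fun hp' =>
    (hR hp').not_ge hp]
  exact eq_neg_of_add_eq_zero_right h.symm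

/-! ### Passing to the limit in traces -/

section Convergence

variable {α : Type*} [MeasurableSpace α] {μ : Measure α}

theorem integrable_mul_of_memLp_two {u φ : α → ℂ} (hu : MemLp u 2 μ) (hφ : MemLp φ 2 μ) :
    Integrable (fun x => u x * φ x) μ :=
  hu.integrable_mul hφ

theorem tendsto_eLpNorm_mul_zero {a : ℕ → α → ℂ} {φ : α → ℂ}
    (ha : ∀ k, AEStronglyMeasurable (a k) μ) (hφ : MemLp φ 2 μ)
    (h : Tendsto (fun k => eLpNorm (a k) 2 μ) atTop (𝓝 0)) :
    Tendsto (fun k => eLpNorm (fun x => a k x * φ x) 1 μ) atTop (𝓝 0) := by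
  have hlim : Tendsto (fun k => eLpNorm (a k) 2 μ * eLpNorm φ 2 μ) atTop (𝓝 0) := by
    simpa using ENNReal.Tendsto.mul_const h (Or.inr hφ.eLpNorm_ne_top)
  refine tendsto_of_tendsto_of_tendsto_of_le_of_le tendsto_const_nhds hlim (fun _ => zero_le)
    fun k => ?_
  have := eLpNorm_smul_le_mul_eLpNorm (p := 2) (q := 2) (r := 1) hφ.1 (ha k)
  change eLpNorm (a k * φ) 1 μ ≤ _
  simpa only [smul_eq_mul] using this

theorem tendsto_integral_mul_of_tendsto_eLpNorm {v : ℕ → α → ℂ} {u φ : α → ℂ}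
    (hv : ∀ k, MemLp (v k) 2 μ) (hu : MemLp u 2 μ) (hφ : MemLp φ 2 μ)
    (h : Tendsto (fun k => eLpNorm (fun x => v k x - u x) 2 μ) atTop (𝓝 0)) :
    Tendsto (fun k => ∫ x, v k x * φ x ∂μ) atTop (𝓝 (∫ x, u x * φ x ∂μ)) := by
  refine tendsto_integral_of_L1' _ (integrable_mul_of_memLp_two hu hφ).1
    (Eventually.of_forall fun k => integrable_mul_of_memLp_two (hv k) hφ) ?_
  have := tendsto_eLpNorm_mul_zero (fun k => ((hv k).sub hu).1) hφ h
  refine this.congr fun k => ?_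
  congr 1
  funext x
  simp [sub_mul]

theorem tendsto_integral_norm_mul_zero {a : ℕ → α → ℂ} {φ : α → ℂ}
    (ha : ∀ k, AEStronglyMeasurable (a k) μ) (hφ : MemLp φ 2 μ)
    (h : Tendsto (fun k => eLpNorm (a k) 2 μ) atTop (𝓝 0)) :
    Tendsto (fun k => ∫ x, ‖a k x * φ x‖ ∂μ) atTop (𝓝 0) := by
  have h2 := (ENNReal.tendsto_toReal ENNReal.zero_ne_top).comp (tendsto_eLpNorm_mul_zero ha hφ h)
  refine h2.congr fun k => ?_
  rw [Function.comp, eLpNorm_one_eq_lintegral_enorm]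
  exact (integral_norm_eq_lintegral_enorm ((ha k).mul hφ.1)).symm

end Convergence

theorem memLp_of_continuous_of_subset {Ω : Set Space} {R : ℝ} (hΩ : Ω ⊆ {p | ‖p.1‖ ≤ R})
    {u : Space → ℂ} (hu : Continuous u) : MemLp u 2 (volume.restrict Ω) := by
  set K : Set Space := Metric.closedBall (0 : ℂ) R ×ˢ Set.univ
  have hK : IsCompact K := (isCompact_closedBall (0 : ℂ) R).prod isCompact_univ
  have hΩK : Ω ⊆ K := fun p hp => ⟨by simpa using hΩ hp, trivial⟩
  obtain ⟨C, hC⟩ := hK.exists_bound_of_continuousOn hu.continuousOn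
  have : IsFiniteMeasure (volume.restrict K) := ⟨by simpa using hK.measure_lt_top⟩
  refine MemLp.mono_measure (Measure.restrict_mono hΩK le_rfl) (MemLp.of_bound
    hu.aestronglyMeasurable C ?_)
  exact (ae_restrict_iff' hK.measurableSet).2 (Eventually.of_forall hC)

theorem memLp_of_continuous_hasCompactSupport {φ : Space → ℂ} (hc : Continuous φ)
    (hs : HasCompactSupport φ) (Ω : Set Space) : MemLp φ 2 (volume.restrict Ω) :=
  (hc.memLp_of_hasCompactSupport hs (μ := volume) (p := 2)).restrict Ω

theorem openSolidTorus_subset : openSolidTorus ⊆ {p | ‖p.1‖ ≤ 1} := fun _ hp => LT.lt.le (α := ℝ) hp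

theorem shell_subset (R : ℝ) : shell R ⊆ {p | ‖p.1‖ ≤ R} := fun _ hp => hp.2.le

/-- The limit is the boundary term that integration by parts of u against φ would produce. It arises
from the product rule for the smooth approximants and L² convergence of values and gradients. -/
theorem HasTrace.exists_tendsto {Ω : Set Space} {R : ℝ} (hΩ : Ω ⊆ {p | ‖p.1‖ ≤ R})
    {u : Space → ℂ} {g : S1 × S1 → ℂ} (h : HasTrace Ω u g) :
    ∃ w, HasH1Gradient Ω u w ∧ ∃ v : ℕ → Space → ℂ, (∀ k, IsSmooth (v k)) ∧
      Tendsto (fun k => eLpNorm (fun q => v k (boundaryPoint q) - g q) 2 volume) atTop (𝓝 0) ∧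
      ∀ (j : Fin 3) (φ : Space → ℂ), IsSmooth φ → HasCompactSupport φ →
        Tendsto (fun k => ∫ p in Ω, partialDeriv j (fun p => v k p * φ p) p) atTop
          (𝓝 ((∫ p in Ω, w j p * φ p) + ∫ p in Ω, u p * partialDeriv j φ p)) := by
  obtain ⟨-, w, hw, v, hv, hvu, hvw, hvg⟩ := h
  refine ⟨w, hw, v, hv, hvg, fun j φ hφ hs => ?_⟩
  have hφ2 := memLp_of_continuous_hasCompactSupport hφ.continuous hs Ω
  have hdφ2 := memLp_of_continuous_hasCompactSupport (hφ.continuous_partialDeriv j)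
    (hasCompactSupport_partialDeriv hs j) Ω
  have hv2 := fun k => memLp_of_continuous_of_subset hΩ (hv k).continuous
  have hdv2 := fun k => memLp_of_continuous_of_subset hΩ ((hv k).continuous_partialDeriv j)
  have t1 := tendsto_integral_mul_of_tendsto_eLpNorm hdv2 (hw.2 j).1 hφ2 (hvw j)
  have t2 := tendsto_integral_mul_of_tendsto_eLpNorm hv2 hw.1 hdφ2 hvu
  refine (t1.add t2).congr fun k => ?_
  rw [← integral_add (integrable_mul_of_memLp_two (hdv2 k) hφ2)
    (integrable_mul_of_memLp_two (hv2 k) hdφ2)]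
  exact integral_congr_ae (Eventually.of_forall fun p => ((hv k).partialDeriv_mul hφ j p).symm)

/-- Each bracket is a boundary term, and the two have opposite orientation. For the approximants
their sum is the integral over the solid torus of a partial derivative of (v_k - v'_k) φ, hence is
bounded by the boundary integral of |v_k - v'_k| |φ|. This tends to 0 because both approximants
converge to the same g. -/
theorem exists_gradients_glue {u u' : Space → ℂ} {g : S1 × S1 → ℂ}
    (h : HasTrace openSolidTorus u g) (h' : HasTrace (shell 2) u' g) :
    ∃ w w', HasH1Gradient openSolidTorus u w ∧ HasH1Gradient (shell 2) u' w' ∧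
      ∀ (j : Fin 3) (φ : Space → ℂ), IsSmooth φ → HasCompactSupport φ →
        tsupport φ ⊆ {p | ‖p.1‖ < 2} →
        ((∫ p in openSolidTorus, w j p * φ p) + ∫ p in openSolidTorus, u p * partialDeriv j φ p) +
        ((∫ p in shell 2, w' j p * φ p) + ∫ p in shell 2, u' p * partialDeriv j φ p) = 0 := by
  have hg := h.1
  obtain ⟨w, hw, v, hv, hvg, hlim⟩ := h.exists_tendsto openSolidTorus_subset
  obtain ⟨w', hw', v', hv', hvg', hlim'⟩ := h'.exists_tendsto (shell_subset 2)
  refine ⟨w, w', hw, hw', fun j φ hφ hs hsub => ?_⟩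
  refine tendsto_nhds_unique ((hlim j φ hφ hs).add (hlim' j φ hφ hs)) ?_
  have hb : ∀ k, Continuous (fun q => v k (boundaryPoint q)) := fun k =>
    (hv k).continuous.comp continuous_boundaryPoint
  have hb' : ∀ k, Continuous (fun q => v' k (boundaryPoint q)) := fun k =>
    (hv' k).continuous.comp continuous_boundaryPoint
  have hφb : Continuous (fun q => φ (boundaryPoint q)) := hφ.continuous.comp continuous_boundaryPoint
  have hdiff : Tendsto (fun k => eLpNorm
      (fun q => v k (boundaryPoint q) - v' k (boundaryPoint q)) 2 volume) atTop (𝓝 0) := by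
    refine tendsto_of_tendsto_of_tendsto_of_le_of_le tendsto_const_nhds
      (by simpa using hvg.add hvg') (fun _ => zero_le) fun k => ?_
    have := eLpNorm_sub_le (p := 2) (μ := (volume : Measure (S1 × S1)))
      (((hb k).aestronglyMeasurable (μ := volume)).sub hg.1)
      (((hb' k).aestronglyMeasurable (μ := volume)).sub hg.1) (by norm_num)
    refine le_trans (le_of_eq ?_) this
    congr 1
    funext q
    simp
  have hnorm := tendsto_integral_norm_mul_zero
    (fun k => ((hb k).sub (hb' k)).aestronglyMeasurable)
    (hφb.memLp_of_hasCompactSupport (HasCompactSupport.of_compactSpace _)) hdiff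
  refine squeeze_zero_norm (fun k => ?_) hnorm
  have hsm := ((hv k).sub (hv' k)).mul hφ
  refine le_trans (le_of_eq ?_) (norm_integral_openSolidTorus_partialDeriv_le hsm j)
  rw [setIntegral_shell_partialDeriv ((hv' k).mul hφ) (hs.mul_left)
    ((tsupport_mul_subset_right).trans hsub), ← sub_eq_add_neg, ← integral_sub]
  · congr 1
    refine integral_congr_ae (Eventually.of_forall fun p => ?_)
    simp only [← ((hv k).mul hφ).partialDeriv_sub ((hv' k).mul hφ), sub_mul]
  · exact (((hv k).mul hφ).continuous_partialDeriv j).integrable_of_hasCompactSupport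
      (hasCompactSupport_partialDeriv hs.mul_left j) |>.integrableOn
  · exact (((hv' k).mul hφ).continuous_partialDeriv j).integrable_of_hasCompactSupport
      (hasCompactSupport_partialDeriv hs.mul_left j) |>.integrableOn

/-! ### Cutoffs and independence of the choice of weak gradient -/

/-- A smooth function of `z` which vanishes where `ρ ≤ 1 / m` and tends to `1` where `0 < ρ`. -/
def cutoff (ρ : ℂ → ℝ) (m : ℝ) (p : Space) : ℂ := (Real.smoothTransition (m * ρ p.1 - 1) : ℝ)

section cutoff

variable {ρ : ℂ → ℝ}

theorem isSmooth_cutoff (hρ : ContDiff ℝ ∞ ρ) (m : ℝ) : IsSmooth (cutoff ρ m) := by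
  have h : ContDiff ℝ ∞ (fun q : ℂ × ℝ => m * ρ q.1 - 1) :=
    (contDiff_const.mul (hρ.comp contDiff_fst)).sub contDiff_const
  exact Complex.ofRealCLM.contDiff.comp (Real.smoothTransition.contDiff.comp h)

theorem norm_cutoff_le (m : ℝ) (p : Space) : ‖cutoff ρ m p‖ ≤ 1 := by
  rw [cutoff, Complex.norm_real, Real.norm_of_nonneg (Real.smoothTransition.nonneg _)]
  exact Real.smoothTransition.le_one _

theorem tsupport_cutoff_subset (hρ : Continuous ρ) (m : ℝ) :
    tsupport (cutoff ρ m) ⊆ {p | 1 ≤ m * ρ p.1} := by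
  refine closure_minimal (fun p hp => ?_) (isClosed_le continuous_const (by fun_prop))
  by_contra h
  have h' : m * ρ p.1 < 1 := not_le.1 h
  refine hp ?_
  rw [cutoff, Real.smoothTransition.zero_of_nonpos (by linarith), Complex.ofReal_zero]

theorem cutoff_eq_one {m : ℝ} {p : Space} (h : 2 ≤ m * ρ p.1) : cutoff ρ m p = 1 := by
  rw [cutoff, Real.smoothTransition.one_of_one_le (by linarith), Complex.ofReal_one]

theorem tendsto_cutoff {p : Space} (h : 0 < ρ p.1) :
    Tendsto (fun m : ℕ => cutoff ρ m p) atTop (𝓝 1) := by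
  refine tendsto_const_nhds.congr' ?_
  filter_upwards [(tendsto_natCast_atTop_atTop (R := ℝ)).eventually_ge_atTop (2 / ρ p.1)] with m hm
  exact (cutoff_eq_one ((div_le_iff₀ h).1 hm)).symm

end cutoff

/-- Two weak derivatives of the same function have the same integral against test functions
which need not vanish on the part `{ρ = 0}` of the boundary. -/
theorem HasWeakDeriv.setIntegral_mul_eq {Ω : Set Space} (hΩ : IsOpen Ω) {j : Fin 3}
    {u w w' : Space → ℂ} (h : HasWeakDeriv Ω j u w) (h' : HasWeakDeriv Ω j u w')
    (hw : MemLp w 2 (volume.restrict Ω)) (hw' : MemLp w' 2 (volume.restrict Ω))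
    {φ : Space → ℂ} (hφ : IsSmooth φ) (hs : HasCompactSupport φ) {ρ : ℂ → ℝ}
    (hρ : ContDiff ℝ ∞ ρ) (hpos : ∀ p ∈ Ω, 0 < ρ p.1)
    (hsupp : ∀ p ∈ tsupport φ, 0 < ρ p.1 → p ∈ Ω) :
    ∫ p in Ω, w p * φ p = ∫ p in Ω, w' p * φ p := by
  have hφ2 := memLp_of_continuous_hasCompactSupport hφ.continuous hs Ω
  -- Multiplication by `cutoff ρ m` makes φ vanish near {ρ = 0}, so that it becomes an admissible
  -- test function. Dominated convergence as m → ∞ removes the cutoff.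
  have key : ∀ w, MemLp w 2 (volume.restrict Ω) →
      Tendsto (fun m : ℕ => ∫ p in Ω, w p * (cutoff ρ m p * φ p)) atTop
        (𝓝 (∫ p in Ω, w p * φ p)) := by
    intro w hw
    have hint := hw.integrable_mul hφ2
    refine tendsto_integral_of_dominated_convergence (fun p => ‖w p * φ p‖) (fun m => ?_)
      hint.norm (fun m => Eventually.of_forall fun p => ?_) ?_
    · exact hw.1.mul (((isSmooth_cutoff hρ m).mul hφ).continuous.aestronglyMeasurable)
    · rw [mul_left_comm, norm_mul]
      exact mul_le_of_le_one_left (norm_nonneg _) (norm_cutoff_le _ _)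
    · refine (ae_restrict_iff' hΩ.measurableSet).2 (Eventually.of_forall fun p hp => ?_)
      simpa using ((tendsto_cutoff (hpos p hp)).mul_const (φ p)).const_mul (w p)
  refine tendsto_nhds_unique (key w hw) ((key w' hw').congr fun m => ?_)
  have hsm := (isSmooth_cutoff hρ m).mul hφ
  have hcs : HasCompactSupport (fun p => cutoff ρ m p * φ p) := hs.mul_left
  have hsub : tsupport (fun p => cutoff ρ m p * φ p) ⊆ Ω := by
    intro p hp
    refine hsupp p (tsupport_mul_subset_right hp) ?_
    have h1 : 1 ≤ (m : ℝ) * ρ p.1 :=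
      tsupport_cutoff_subset hρ.continuous m (tsupport_mul_subset_left hp)
    exact pos_of_mul_pos_right (one_pos.trans_le h1) m.cast_nonneg
  exact neg_injective ((h' _ hsm hcs hsub).symm.trans (h _ hsm hcs hsub))

/-! ### Integration by parts across the boundary torus -/

theorem contDiff_norm_sq_sub (c : ℝ) : ContDiff ℝ ∞ (fun z : ℂ => ‖z‖ ^ 2 - c) :=
  (contDiff_norm_sq ℝ).sub contDiff_const

theorem contDiff_sub_norm_sq (c : ℝ) : ContDiff ℝ ∞ (fun z : ℂ => c - ‖z‖ ^ 2) :=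
  contDiff_const.sub (contDiff_norm_sq ℝ)

theorem one_lt_of_norm_sq_sub_pos {z : ℂ} (h : 0 < ‖z‖ ^ 2 - 1) : 1 < ‖z‖ := by
  by_contra h'
  nlinarith [norm_nonneg z, not_lt.1 h']

theorem integrableOn_exterior_mul {R : ℝ} {a ψ : Space → ℂ}
    (ha : MemLp a 2 (volume.restrict (shell R))) (hψ : Continuous ψ) (hs : HasCompactSupport ψ)
    (h0 : ∀ p : Space, R ≤ ‖p.1‖ → ψ p = 0) : IntegrableOn (fun p => a p * ψ p) exterior := by
  have h1 : IntegrableOn (fun p => a p * ψ p) (shell R) :=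
    ha.integrable_mul (memLp_of_continuous_hasCompactSupport hψ hs _)
  refine h1.of_forall_sdiff_eq_zero isOpen_exterior.measurableSet fun p hp => ?_
  rw [h0 p, mul_zero]
  by_contra hlt
  exact hp.2 ⟨hp.1, not_le.1 hlt⟩

theorem exists_radius_of_hasCompactSupport {φ : Space → ℂ} (hs : HasCompactSupport φ) :
    ∃ R : ℝ, 2 ≤ R ∧ tsupport φ ⊆ {p | ‖p.1‖ < R} := by
  obtain ⟨C, hC⟩ := hs.isCompact.exists_bound_of_continuousOn
    (f := fun p : Space => p.1) continuous_fst.continuousOn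
  exact ⟨max 2 (C + 1), le_max_left _ _, fun p hp =>
    lt_max_of_lt_right ((hC p hp).trans_lt (lt_add_one C))⟩

theorem HasH1LocGradient.integrableOn_exterior_gradient_mul {u : Space → ℂ}
    {w : Fin 3 → Space → ℂ} (h : HasH1LocGradient u w) (j : Fin 3) {ψ : Space → ℂ}
    (hψ : Continuous ψ) (hs : HasCompactSupport ψ) :
    IntegrableOn (fun p => w j p * ψ p) exterior := by
  obtain ⟨R, hR2, hR⟩ := exists_radius_of_hasCompactSupport hs
  exact integrableOn_exterior_mul ((h R (by linarith)).2 j).1 hψ hs fun p hp =>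
    image_eq_zero_of_notMem_tsupport fun hm => (hR hm).not_ge hp

/-- An `H¹` function on the solid torus and an `H¹_loc` function on the exterior with the same
trace satisfy the integration by parts formula on all of `ℂ × S¹`. -/
theorem glue_weak_derivatives {u u' : Space → ℂ} {w w' : Fin 3 → Space → ℂ} {g : S1 × S1 → ℂ}
    (hu : HasH1Gradient openSolidTorus u w) (hu' : HasH1LocGradient u' w')
    (h : HasTrace openSolidTorus u g) (h' : HasTrace (shell 2) u' g) (j : Fin 3)
    {φ : Space → ℂ} (hφ : IsSmooth φ) (hs : HasCompactSupport φ) :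
    (∫ p in openSolidTorus, u p * partialDeriv j φ p) + (∫ p in exterior, u' p * partialDeriv j φ p) =
      -((∫ p in openSolidTorus, w j p * φ p) + ∫ p in exterior, w' j p * φ p) := by
  obtain ⟨w₁, w₁', hw₁, hw₁', hglue⟩ := exists_gradients_glue h h'
  -- χ is 0 for |z|² ≤ 2 and 1 for |z|² ≥ 3. So χφ stays away from the torus, where the weak
  -- derivative of u' suffices, while φ - χφ is supported in |z|² ≤ 3, inside |z| < 2 where the
  -- trace on `shell 2` applies.
  set χ : Space → ℂ := cutoff (fun z => ‖z‖ ^ 2 - 1) 1 with hχ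
  have hχs : IsSmooth χ := isSmooth_cutoff (contDiff_norm_sq_sub 1) 1
  set φ₂ : Space → ℂ := fun p => χ p * φ p with hφ₂
  set φ₁ : Space → ℂ := fun p => φ p - χ p * φ p with hφ₁
  have hφ₂s : IsSmooth φ₂ := hχs.mul hφ
  have hφ₁s : IsSmooth φ₁ := hφ.sub hφ₂s
  have hs₂ : HasCompactSupport φ₂ := hs.mul_left
  have hs₁ : HasCompactSupport φ₁ := hs.sub hs₂
  have hsupp₂ : tsupport φ₂ ⊆ exterior := fun p hp => by
    have h1 : (1 : ℝ) ≤ 1 * (‖p.1‖ ^ 2 - 1) :=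
      tsupport_cutoff_subset (contDiff_norm_sq_sub 1).continuous 1 (tsupport_mul_subset_left hp)
    exact one_lt_of_norm_sq_sub_pos (by linarith)
  have hsupp₁ : tsupport φ₁ ⊆ {p | ‖p.1‖ < 2} := by
    refine (closure_minimal (t := {p : Space | ‖p.1‖ ^ 2 ≤ 3}) (fun p hp => ?_)
      (isClosed_le (by fun_prop) continuous_const)).trans fun p (hp : ‖p.1‖ ^ 2 ≤ 3) => ?_
    · by_contra hlt
      have hlt' : 3 < ‖p.1‖ ^ 2 := not_le.1 hlt
      refine hp ?_
      simp only [hφ₁, hχ]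
      rw [cutoff_eq_one (by linarith)]
      simp
    · change ‖p.1‖ < 2
      nlinarith [norm_nonneg p.1]
  obtain ⟨R, hR2, hR⟩ := exists_radius_of_hasCompactSupport hs
  have hR₂ : tsupport φ₂ ⊆ {p | ‖p.1‖ < R} := tsupport_mul_subset_right.trans hR
  have hz : ∀ {ψ : Space → ℂ} {r : ℝ}, tsupport ψ ⊆ {p | ‖p.1‖ < r} → ∀ p : Space, r ≤ ‖p.1‖ →
      ψ p = 0 ∧ partialDeriv j ψ p = 0 := fun hψ p hp =>
    ⟨image_eq_zero_of_notMem_tsupport fun hm => (hψ hm).not_ge hp,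
      partialDeriv_eq_zero_of_notMem_tsupport j fun hm => (hψ hm).not_ge hp⟩
  -- the part near the torus
  have e1 : ∫ p in openSolidTorus, w₁ j p * φ₁ p = ∫ p in openSolidTorus, w j p * φ₁ p :=
    (hw₁.2 j).2.setIntegral_mul_eq isOpen_openSolidTorus (hu.2 j).2 (hw₁.2 j).1 (hu.2 j).1 hφ₁s hs₁
      (contDiff_sub_norm_sq 1)
      (fun p (hp : ‖p.1‖ < 1) => by nlinarith [norm_nonneg p.1])
      (fun p _ hp => by
        change ‖p.1‖ < 1
        nlinarith [norm_nonneg p.1])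
  -- The function ρ = |z|² - 1 vanishes only on the inner boundary of the shell; the outer one is
  -- avoided by the support of φ₁.
  have e2 : ∫ p in shell 2, w₁' j p * φ₁ p = ∫ p in shell 2, w' j p * φ₁ p := by
    have hu2 := hu' 2 (by norm_num)
    exact (hw₁'.2 j).2.setIntegral_mul_eq (isOpen_shell 2) (hu2.2 j).2 (hw₁'.2 j).1 (hu2.2 j).1
      hφ₁s hs₁ (contDiff_norm_sq_sub 1) (fun p hp => by nlinarith [hp.1])
      (fun p hp hpos => ⟨one_lt_of_norm_sq_sub_pos hpos, hsupp₁ hp⟩)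
  have hg := hglue j φ₁ hφ₁s hs₁ hsupp₁
  rw [e1, e2, setIntegral_shell_eq fun p hp => by rw [(hz hsupp₁ p hp).1, mul_zero],
    setIntegral_shell_eq fun p hp => by rw [(hz hsupp₁ p hp).2, mul_zero]] at hg
  -- the part away from the torus
  have hR1 := hu' R (by linarith)
  have hw2 := (hR1.2 j).2 φ₂ hφ₂s hs₂ fun p hp => ⟨hsupp₂ hp, hR₂ hp⟩
  rw [setIntegral_shell_eq fun p hp => by rw [(hz hR₂ p hp).2, mul_zero],
    setIntegral_shell_eq fun p hp => by rw [(hz hR₂ p hp).1, mul_zero]] at hw2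
  have hin : ∀ p ∈ openSolidTorus, φ₂ p = 0 ∧ partialDeriv j φ₂ p = 0 := fun p hp =>
    ⟨image_eq_zero_of_notMem_tsupport fun hm => lt_asymm (α := ℝ) (hsupp₂ hm) hp,
      partialDeriv_eq_zero_of_notMem_tsupport j fun hm => lt_asymm (α := ℝ) (hsupp₂ hm) hp⟩
  have hd : ∀ p, partialDeriv j φ₁ p = partialDeriv j φ p - partialDeriv j φ₂ p :=
    hφ.partialDeriv_sub hφ₂s j
  have i1 : ∫ p in openSolidTorus, u p * partialDeriv j φ₁ p =
      ∫ p in openSolidTorus, u p * partialDeriv j φ p :=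
    setIntegral_congr_fun isOpen_openSolidTorus.measurableSet fun p hp => by
      simp [hd, (hin p hp).2]
  have i2 : ∫ p in openSolidTorus, w j p * φ₁ p = ∫ p in openSolidTorus, w j p * φ p :=
    setIntegral_congr_fun isOpen_openSolidTorus.measurableSet fun p hp => by
      have := (hin p hp).1
      simp only [hφ₂] at this
      simp [hφ₁, this]
  have i3 : ∫ p in exterior, u' p * partialDeriv j φ₁ p =
      (∫ p in exterior, u' p * partialDeriv j φ p) - ∫ p in exterior, u' p * partialDeriv j φ₂ p := by
    rw [← integral_sub]
    · simp only [hd, mul_sub]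
    · exact integrableOn_exterior_mul hR1.1 (hφ.continuous_partialDeriv j) (hasCompactSupport_partialDeriv hs j)
        fun p hp => (hz hR p hp).2
    · exact integrableOn_exterior_mul hR1.1 (hφ₂s.continuous_partialDeriv j) (hasCompactSupport_partialDeriv hs₂ j)
        fun p hp => (hz hR₂ p hp).2
  have i4 : ∫ p in exterior, w' j p * φ₁ p =
      (∫ p in exterior, w' j p * φ p) - ∫ p in exterior, w' j p * φ₂ p := by
    rw [← integral_sub]
    · simp only [hφ₁, hφ₂, mul_sub]
    · exact integrableOn_exterior_mul (hR1.2 j).1 hφ.continuous hs fun p hp => (hz hR p hp).1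
    · exact integrableOn_exterior_mul (hR1.2 j).1 hφ₂s.continuous hs₂ fun p hp => (hz hR₂ p hp).1
  rw [i1, i2, i3, i4] at hg
  linear_combination hg + hw2

/-! ### The equation of one mode in the plane, by Fourier transform -/

section Schwartz

open SchwartzMap FourierTransform LineDeriv

/-- A fixed smooth bump function on `ℂ`, equal to `1` on the unit disc. -/
def planeBump : ContDiffBump (0 : ℂ) := ⟨1, 2, one_pos, one_lt_two⟩

/-- The rescaled bump functions, which exhaust the plane. -/
def scaledBump (s : ℝ) (z : ℂ) : ℂ := (planeBump (s • z) : ℝ)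

theorem contDiff_scaledBump (s : ℝ) : ContDiff ℝ ∞ (scaledBump s) :=
  Complex.ofRealCLM.contDiff.comp (planeBump.contDiff.comp (contDiff_const_smul s))

theorem hasCompactSupport_scaledBump {s : ℝ} (hs : s ≠ 0) : HasCompactSupport (scaledBump s) := by
  have h : HasCompactSupport (fun z : ℂ => planeBump (s • z)) :=
    planeBump.hasCompactSupport.comp_homeomorph (Homeomorph.smulOfNeZero s hs)
  exact h.comp_left (g := fun x : ℝ => (x : ℂ)) Complex.ofReal_zero

theorem norm_scaledBump_le (s : ℝ) (z : ℂ) : ‖scaledBump s z‖ ≤ 1 := by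
  rw [scaledBump, Complex.norm_real, Real.norm_of_nonneg planeBump.nonneg]
  exact planeBump.le_one

theorem fderiv_scaledBump (s : ℝ) (z v : ℂ) :
    fderiv ℝ (scaledBump s) z v = ((s * fderiv ℝ planeBump (s • z) v : ℝ) : ℂ) := by
  have h1 : HasFDerivAt (fun z : ℂ => s • z) (s • ContinuousLinearMap.id ℝ ℂ) z :=
    (hasFDerivAt_id z).const_smul s
  have h2 : HasFDerivAt planeBump (fderiv ℝ planeBump (s • z)) (s • z) :=
    ((planeBump.contDiff (n := 1)).differentiable one_ne_zero _).hasFDerivAt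
  have h3 : HasFDerivAt (scaledBump s) _ z := Complex.ofRealCLM.hasFDerivAt.comp z (h2.comp z h1)
  rw [h3.fderiv]
  simp

theorem exists_norm_fderiv_scaledBump_le (v : ℂ) :
    ∃ C : ℝ, 0 ≤ C ∧ ∀ (s : ℝ) (z : ℂ), ‖fderiv ℝ (scaledBump s) z v‖ ≤ |s| * C := by
  have hc : Continuous (fun z => fderiv ℝ planeBump z v) :=
    ((planeBump.contDiff (n := 1)).continuous_fderiv one_ne_zero).clm_apply continuous_const
  obtain ⟨C, hC⟩ := (planeBump.hasCompactSupport.fderiv_apply (𝕜 := ℝ) v).exists_bound_of_continuous hc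
  refine ⟨C, (norm_nonneg _).trans (hC 0), fun s z => ?_⟩
  rw [fderiv_scaledBump, Complex.norm_real, norm_mul, Real.norm_eq_abs]
  exact mul_le_mul_of_nonneg_left (hC _) (abs_nonneg s)

theorem fderiv_scaledBump_mul (s : ℝ) {f : ℂ → ℂ} (hf : Differentiable ℝ f) (z v : ℂ) :
    fderiv ℝ (fun z => scaledBump s z * f z) z v =
      scaledBump s z * fderiv ℝ f z v + fderiv ℝ (scaledBump s) z v * f z := by
  rw [fderiv_fun_mul ((contDiff_scaledBump s).differentiable (by simp) z) (hf z)]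
  simp [mul_comm]

theorem tendsto_scaledBump {s : ℕ → ℝ} (hs : Tendsto s atTop (𝓝 0)) (z : ℂ) :
    Tendsto (fun m => scaledBump (s m) z) atTop (𝓝 1) := by
  have h : Tendsto (fun m => scaledBump (s m) z) atTop (𝓝 (scaledBump 0 z)) := by
    have hc : Continuous (fun t : ℝ => scaledBump t z) :=
      Complex.continuous_ofReal.comp ((planeBump.contDiff (n := 0)).continuous.comp (by fun_prop))
    exact (hc.tendsto 0).comp hs
  convert h using 2
  rw [scaledBump, zero_smul, planeBump.one_of_mem_closedBall, Complex.ofReal_one]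
  simp [planeBump]

/-- The Hilbert space `L²(ℂ, ℂ)`. -/
abbrev L2C : Type := Lp ℂ 2 (volume : Measure ℂ)

variable {a b c : ℂ → ℂ}

theorem tendsto_integral_scaledBump_mul (hb : MemLp b 2) {s : ℕ → ℝ} (hs : Tendsto s atTop (𝓝 0))
    (f : 𝓢(ℂ, ℂ)) :
    Tendsto (fun m => ∫ z, b z * (scaledBump (s m) z * f z)) atTop (𝓝 (∫ z, b z * f z)) := by
  have hi := integrable_mul_of_memLp_two hb (f.memLp 2)
  refine tendsto_integral_of_dominated_convergence (fun z => ‖b z * f z‖) (fun m => ?_)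
    hi.norm (fun m => Eventually.of_forall fun z => ?_) (Eventually.of_forall fun z => ?_)
  · exact hb.1.mul ((contDiff_scaledBump _).continuous.mul f.continuous).aestronglyMeasurable
  · rw [mul_left_comm, norm_mul]
    exact mul_le_of_le_one_left (norm_nonneg _) (norm_scaledBump_le _ _)
  · simpa using ((tendsto_scaledBump hs z).mul_const (f z)).const_mul (b z)

/-- By the product rule, the term in which the derivative falls on the bump carries a factor s, and
so disappears in the limit. -/
theorem tendsto_integral_fderiv_scaledBump_mul (hb : MemLp b 2) {s : ℕ → ℝ}
    (hs : Tendsto s atTop (𝓝 0)) (f : 𝓢(ℂ, ℂ)) (v : ℂ) :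
    Tendsto (fun m => ∫ z, b z * fderiv ℝ (fun z => scaledBump (s m) z * f z) z v) atTop
      (𝓝 (∫ z, b z * fderiv ℝ f z v)) := by
  obtain ⟨C, hC0, hC⟩ := exists_norm_fderiv_scaledBump_le v
  have hi := integrable_mul_of_memLp_two hb (f.memLp 2)
  have hcont : ∀ t, Continuous (fun z => fderiv ℝ (scaledBump t) z v) := fun t =>
    ((contDiff_scaledBump t).continuous_fderiv (by simp)).clm_apply continuous_const
  have h1 := tendsto_integral_scaledBump_mul hb hs (∂_{v} f)
  have h2 : Tendsto (fun m => ∫ z, b z * (fderiv ℝ (scaledBump (s m)) z v * f z)) atTop (𝓝 0) := by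
    have hlim : Tendsto (fun m => |s m| * C * ∫ z, ‖b z * f z‖) atTop (𝓝 0) := by
      simpa using ((hs.abs.mul_const C).mul_const (∫ z, ‖b z * f z‖))
    refine squeeze_zero_norm (fun m => ?_) hlim
    rw [← integral_const_mul]
    refine norm_integral_le_of_norm_le (hi.norm.const_mul _) (Eventually.of_forall fun z => ?_)
    rw [mul_left_comm, norm_mul]
    exact mul_le_mul_of_nonneg_right (hC _ _) (norm_nonneg _)
  have hadd := h1.add h2
  rw [add_zero] at hadd
  refine hadd.congr fun m => ?_
  rw [← integral_add]
  · refine integral_congr_ae (Eventually.of_forall fun z => ?_)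
    simp only [fderiv_scaledBump_mul _ f.differentiable, lineDerivOp_apply_eq_fderiv]
    ring
  · refine (integrable_mul_of_memLp_two hb ((∂_{v} f).memLp 2)).norm.mono'
      (hb.1.mul ((contDiff_scaledBump _).continuous.mul (∂_{v} f).continuous).aestronglyMeasurable)
      (Eventually.of_forall fun z => ?_)
    rw [mul_left_comm, norm_mul]
    exact mul_le_of_le_one_left (norm_nonneg _) (norm_scaledBump_le _ _)
  · refine (hi.norm.const_mul (|s m| * C)).mono'
      (hb.1.mul ((hcont _).mul f.continuous).aestronglyMeasurable)
      (Eventually.of_forall fun z => ?_)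
    rw [mul_left_comm, norm_mul]
    exact mul_le_mul_of_nonneg_right (hC _ _) (norm_nonneg _)

/-- The weak form of the equation `a - ∂b/∂x - ∂c/∂y = 0`. -/
def WeakDivEq (a b c : ℂ → ℂ) : Prop :=
  ∀ f : ℂ → ℂ, ContDiff ℝ ∞ f → HasCompactSupport f →
    (∫ z, a z * f z) + (∫ z, b z * fderiv ℝ f z 1) + ∫ z, c z * fderiv ℝ f z Complex.I = 0

/-- The Fourier transform of a compactly supported test function is in general only Schwartz, so the
weak equation has to be extended to Schwartz functions by truncation. -/
theorem WeakDivEq.schwartz (h : WeakDivEq a b c) (ha : MemLp a 2) (hb : MemLp b 2) (hc : MemLp c 2)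
    (f : 𝓢(ℂ, ℂ)) :
    (∫ z, a z * f z) + (∫ z, b z * fderiv ℝ f z 1) + ∫ z, c z * fderiv ℝ f z Complex.I = 0 := by
  have hs : Tendsto (fun m : ℕ => (1 / ((m : ℝ) + 1))) atTop (𝓝 0) :=
    tendsto_one_div_add_atTop_nhds_zero_nat
  have hlim := ((tendsto_integral_scaledBump_mul ha hs f).add
    (tendsto_integral_fderiv_scaledBump_mul hb hs f 1)).add
    (tendsto_integral_fderiv_scaledBump_mul hc hs f Complex.I)
  refine tendsto_nhds_unique hlim (tendsto_const_nhds.congr fun m => ?_)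
  exact (h _ ((contDiff_scaledBump _).mul (f.smooth ⊤))
    (hasCompactSupport_scaledBump (by positivity)).mul_right).symm

/-- On L² the Fourier transform agrees with that of tempered distributions, which is defined by this
duality. -/
theorem integral_fourier_Lp_mul (a : L2C) (g : 𝓢(ℂ, ℂ)) :
    ∫ z, a z * (𝓕 g : 𝓢(ℂ, ℂ)) z = ∫ z, (𝓕 a : L2C) z * g z := by
  have h := congrArg (fun T : 𝓢'(ℂ, ℂ) => T g) (Lp.fourier_toTemperedDistribution_eq a)
  simpa [TemperedDistribution.fourier_apply, mul_comm] using h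

/-- A derivative of 𝓕 g is the transform of g multiplied by a linear function; duality then moves 𝓕
onto a. -/
theorem integral_fderiv_fourier (a : L2C) (g : 𝓢(ℂ, ℂ)) (v : ℂ) :
    ∫ z, a z * fderiv ℝ (𝓕 g : 𝓢(ℂ, ℂ)) z v =
      ∫ z, (𝓕 a : L2C) z *
        (-(2 * Real.pi * Complex.I) * ((inner ℝ z v : ℝ) * g z)) := by
  have h1 : ∀ z, fderiv ℝ (𝓕 g : 𝓢(ℂ, ℂ)) z v = ∂_{v} (𝓕 g : 𝓢(ℂ, ℂ)) z := fun z => rfl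
  simp only [h1]
  rw [lineDerivOp_fourier_eq, integral_fourier_Lp_mul]
  refine integral_congr_ae (Eventually.of_forall fun z => ?_)
  change _ * (-(2 * Real.pi * Complex.I) • smulLeftCLM ℂ (inner ℝ · v) g) z = _
  rw [_root_.smul_apply, smulLeftCLM_apply_apply
    (Function.hasTemperateGrowth_inner_left v), Complex.real_smul, smul_eq_mul]

theorem locallyIntegrable_Lp_mul (a : L2C) {m : ℂ → ℂ} (hm : Continuous m) :
    LocallyIntegrable (fun z => a z * m z) :=
  ((Lp.memLp a).locallyIntegrable (by norm_num)).mul_continuous hm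

/-- The Fourier transform turns the weak equation `a - ∂b/∂x - ∂c/∂y = 0` into a pointwise one. -/
theorem WeakDivEq.fourier (ha : MemLp a 2) (hb : MemLp b 2) (hc : MemLp c 2)
    (h : WeakDivEq a b c) :
    ∀ᵐ ξ : ℂ, (𝓕 (ha.toLp a) : L2C) ξ - 2 * Real.pi * Complex.I *
      (ξ.re * (𝓕 (hb.toLp b) : L2C) ξ + ξ.im * (𝓕 (hc.toLp c) : L2C) ξ) = 0 := by
  set A : L2C := 𝓕 (ha.toLp a)
  set B : L2C := 𝓕 (hb.toLp b)
  set C : L2C := 𝓕 (hc.toLp c)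
  have hre : Continuous (fun ξ : ℂ => -(2 * Real.pi * Complex.I) * (ξ.re : ℂ)) := by fun_prop
  have him : Continuous (fun ξ : ℂ => -(2 * Real.pi * Complex.I) * (ξ.im : ℂ)) := by fun_prop
  have hA := locallyIntegrable_Lp_mul A (continuous_const (y := (1 : ℂ)))
  have hB := locallyIntegrable_Lp_mul B hre
  have hC := locallyIntegrable_Lp_mul C him
  have key := ae_eq_zero_of_integral_contDiff_smul_eq_zero ((hA.add hB).add hC) fun g hg hgs => ?_
  · filter_upwards [key] with ξ hξ
    rw [← hξ]
    simp only [Pi.add_apply]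
    ring
  · have hg' : ContDiff ℝ ∞ (fun z => (g z : ℂ)) := Complex.ofRealCLM.contDiff.comp hg
    have hgs' : HasCompactSupport (fun z => (g z : ℂ)) :=
      hgs.comp_left (g := fun x : ℝ => (x : ℂ)) Complex.ofReal_zero
    set G : 𝓢(ℂ, ℂ) := hgs'.toSchwartzMap hg' with hG
    have hGz : ∀ z, G z = g z := fun z => rfl
    -- Testing the weak equation with 𝓕 G is testing the transformed equation with G.
    have hs := h.schwartz ha hb hc (𝓕 G)
    have ea : ∫ z, a z * (𝓕 G : 𝓢(ℂ, ℂ)) z = ∫ z, A z * G z := by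
      rw [← integral_fourier_Lp_mul]
      exact integral_congr_ae (ha.coeFn_toLp.mono fun z hz => by simp only [hz])
    have eb : ∫ z, b z * fderiv ℝ (𝓕 G : 𝓢(ℂ, ℂ)) z 1 =
        ∫ z, B z * (-(2 * Real.pi * Complex.I) * ((inner ℝ z (1 : ℂ) : ℝ) * G z)) := by
      rw [← integral_fderiv_fourier]
      exact integral_congr_ae (hb.coeFn_toLp.mono fun z hz => by simp only [hz])
    have ec : ∫ z, c z * fderiv ℝ (𝓕 G : 𝓢(ℂ, ℂ)) z Complex.I =
        ∫ z, C z * (-(2 * Real.pi * Complex.I) * ((inner ℝ z Complex.I : ℝ) * G z)) := by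
      rw [← integral_fderiv_fourier]
      exact integral_congr_ae (hc.coeFn_toLp.mono fun z hz => by simp only [hz])
    rw [ea, eb, ec] at hs
    have iA := hA.integrable_smul_left_of_hasCompactSupport hg.continuous hgs
    have iB := hB.integrable_smul_left_of_hasCompactSupport hg.continuous hgs
    have iC := hC.integrable_smul_left_of_hasCompactSupport hg.continuous hgs
    simp only [Pi.add_apply, smul_add]
    have iAB : Integrable (fun z => g z • (A z * 1) +
        g z • (B z * (-(2 * Real.pi * Complex.I) * (z.re : ℂ)))) := iA.add iB
    rw [integral_add iAB iC, integral_add iA iB, ← hs]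
    refine congrArg₂ (· + ·) (congrArg₂ (· + ·) ?_ ?_) ?_ <;>
      refine integral_congr_ae (Eventually.of_forall fun z => ?_)
    · simp [hGz, mul_comm]
    · simp only [hGz, Complex.inner, Complex.real_smul]
      simp
      ring
    · simp only [hGz, Complex.inner, Complex.real_smul]
      simp
      ring

/-- The Fourier mode `n` of a square integrable solution of the Dirac equation vanishes. -/
theorem ae_eq_zero_of_weak_dirac_mode {u₀ u₁ : ℂ → ℂ} (h₀ : MemLp u₀ 2) (h₁ : MemLp u₁ 2) (n : ℤ)
    (e₁ : WeakDivEq (fun z => n * u₀ z) u₁ (fun z => Complex.I * u₁ z))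
    (e₂ : WeakDivEq (fun z => n * u₁ z) u₀ (fun z => -Complex.I * u₀ z)) :
    u₀ =ᵐ[volume] 0 ∧ u₁ =ᵐ[volume] 0 := by
  have f₁ := e₁.fourier (h₀.const_mul _) h₁ (h₁.const_mul _)
  have f₂ := e₂.fourier (h₁.const_mul _) h₀ (h₀.const_mul _)
  have hsm : ∀ (k : ℂ) {u : ℂ → ℂ} (hu : MemLp u 2),
      (𝓕 ((hu.const_mul k).toLp (fun z => k * u z)) : L2C) =ᵐ[volume]
        fun ξ => k * (𝓕 (hu.toLp u) : L2C) ξ := by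
    intro k u hu
    have : (hu.const_mul k).toLp (fun z => k * u z) = k • hu.toLp u := rfl
    rw [this, FourierTransform.fourier_smul]
    exact Lp.coeFn_smul _ _
  -- Needed for n = 0, where the system degenerates exactly at ξ = 0.
  have hne : ∀ᵐ ξ : ℂ, ξ ≠ 0 := by simp [ae_iff]
  have hboth : ∀ᵐ ξ : ℂ, (𝓕 (h₀.toLp u₀) : L2C) ξ = 0 ∧
      (𝓕 (h₁.toLp u₁) : L2C) ξ = 0 := by
    filter_upwards [f₁, f₂, hsm n h₀, hsm n h₁, hsm Complex.I h₁, hsm (-Complex.I) h₀, hne] with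
      ξ k₁ k₂ s₁ s₂ s₃ s₄ hξ
    rw [s₁, s₃] at k₁
    rw [s₂, s₄] at k₂
    set p := (𝓕 (h₀.toLp u₀) : L2C) ξ
    set q := (𝓕 (h₁.toLp u₁) : L2C) ξ
    -- This is the determinant of the system for (p, q). The linear combinations below multiply the
    -- system by its adjugate; the multiples of `hI` only account for i² = -1.
    have hpos : (0 : ℝ) < n ^ 2 + 4 * Real.pi ^ 2 * (ξ.re ^ 2 + ξ.im ^ 2) := by
      have h1 : 0 < ξ.re ^ 2 + ξ.im ^ 2 := by
        have := Complex.normSq_pos.2 hξ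
        rw [Complex.normSq_apply] at this
        nlinarith
      positivity
    have hD : (n ^ 2 + 4 * Real.pi ^ 2 * (ξ.re ^ 2 + ξ.im ^ 2) : ℂ) ≠ 0 := by
      exact_mod_cast hpos.ne'
    have hI := Complex.I_sq
    constructor
    · refine (mul_eq_zero.1 ?_).resolve_left hD
      linear_combination n * k₁ + 2 * Real.pi * Complex.I * (ξ.re + ξ.im * Complex.I) * k₂ +
        4 * Real.pi ^ 2 * p * (ξ.re ^ 2 + (1 - Complex.I ^ 2) * ξ.im ^ 2) * hI
    · refine (mul_eq_zero.1 ?_).resolve_left hD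
      linear_combination n * k₂ + 2 * Real.pi * Complex.I * (ξ.re - ξ.im * Complex.I) * k₁ +
        4 * Real.pi ^ 2 * q * (ξ.re ^ 2 + (1 - Complex.I ^ 2) * ξ.im ^ 2) * hI
  have fin : ∀ {u : ℂ → ℂ} (hu : MemLp u 2),
      (∀ᵐ ξ : ℂ, (𝓕 (hu.toLp u) : L2C) ξ = 0) → u =ᵐ[volume] 0 := by
    intro u hu h
    have hz : 𝓕 (hu.toLp u) = 0 := (Lp.eq_zero_iff_ae_eq_zero).2 h
    have hz2 : hu.toLp u = 0 := by
      -- Plancherel: the Fourier transform preserves the L² norm.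
      rw [← norm_eq_zero, ← Lp.norm_fourier_eq, hz, norm_zero]
    exact hu.coeFn_toLp.symm.trans ((Lp.eq_zero_iff_ae_eq_zero).1 hz2)
  exact ⟨fin h₀ (hboth.mono fun _ h => h.1), fin h₁ (hboth.mono fun _ h => h.2)⟩

end Schwartz

/-! ### Fourier series in θ and vanishing of global solutions -/

section FourierCoefficients

/-- The `n`-th Fourier coefficient in `θ` of a function on `ℂ × S¹`, as a function of `z`. -/
def thetaCoeff (n : ℤ) (U : Space → ℂ) (z : ℂ) : ℂ := ∫ θ : S1, U (z, θ) * fourier n θ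

/-- Completeness of the exponentials in L²(S¹). Normalised Haar measure and arc length differ only
by a constant factor. -/
theorem ae_eq_zero_of_fourier_integrals_eq_zero {g : S1 → ℂ} (hg : MemLp g 2)
    (h : ∀ n : ℤ, ∫ θ : S1, g θ * fourier n θ = 0) : g =ᵐ[volume] 0 := by
  have hg' : MemLp g 2 AddCircle.haarAddCircle := memLp_haarAddCircle_iff.2 hg
  have hcoeff : ∀ n, fourierCoeff (hg'.toLp g) n = 0 := by
    intro n
    rw [fourierCoeff_congr_ae hg'.coeFn_toLp, fourierCoeff, AddCircle.integral_haarAddCircle]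
    -- The n-th Fourier coefficient pairs with the exponential of index -n.
    have := h (-n)
    simp only [smul_eq_mul, mul_comm (fourier (-n) _)]
    rw [this, smul_zero]
  have hs := hasSum_fourier_series_L2 (hg'.toLp g)
  simp only [hcoeff, zero_smul] at hs
  have h0 : hg'.toLp g = 0 := hs.unique hasSum_zero
  have hae : g =ᵐ[AddCircle.haarAddCircle] 0 :=
    hg'.coeFn_toLp.symm.trans ((Lp.eq_zero_iff_ae_eq_zero).1 h0)
  rw [AddCircle.volume_eq_smul_haarAddCircle]
  exact Measure.ae_smul_measure hae _

variable {U : Space → ℂ}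

theorem aestronglyMeasurable_thetaCoeff (hU : MemLp U 2) (n : ℤ) :
    AEStronglyMeasurable (thetaCoeff n U) volume := by
  have h : AEStronglyMeasurable (fun p : Space => U p * fourier n p.2)
      ((volume : Measure ℂ).prod (volume : Measure S1)) :=
    hU.1.mul ((map_continuous (fourier n)).comp continuous_snd).aestronglyMeasurable
  exact h.integral_prod_right'

/-- Cauchy–Schwarz against the constant 1 on a circle of length 2π. Integrated over z, it shows that
the coefficients are in L²(ℂ). -/
theorem enorm_thetaCoeff_sq_le {z : ℂ} (n : ℤ)
    (hz : AEStronglyMeasurable (fun θ : S1 => U (z, θ)) volume) :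
    ‖thetaCoeff n U z‖ₑ ^ (2 : ℝ) ≤
      ENNReal.ofReal (2 * Real.pi) * ∫⁻ θ : S1, ‖U (z, θ)‖ₑ ^ (2 : ℝ) := by
  have h1 : ‖thetaCoeff n U z‖ₑ ≤ ∫⁻ θ : S1, ‖U (z, θ)‖ₑ := by
    refine (enorm_integral_le_lintegral_enorm _).trans (lintegral_mono fun θ => ?_)
    have : ‖(fourier n θ : ℂ)‖ₑ = 1 := by
      rw [← ofReal_norm, fourier_apply, Circle.norm_coe, ENNReal.ofReal_one]
    rw [enorm_mul, this, mul_one]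
  have h2 : ∫⁻ θ : S1, ‖U (z, θ)‖ₑ ≤
      (∫⁻ θ : S1, ‖U (z, θ)‖ₑ ^ (2 : ℝ)) ^ (1 / (2 : ℝ)) *
        ENNReal.ofReal (2 * Real.pi) ^ (1 / (2 : ℝ)) := by
    have := ENNReal.lintegral_mul_le_Lp_mul_Lq (volume : Measure S1) Real.HolderConjugate.two_two
      hz.enorm (aemeasurable_const (b := (1 : ENNReal)))
    simpa using this
  refine (ENNReal.rpow_le_rpow (h1.trans h2) (by norm_num)).trans (le_of_eq ?_)
  rw [ENNReal.mul_rpow_of_nonneg _ _ (by norm_num), ← ENNReal.rpow_mul, ← ENNReal.rpow_mul]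
  norm_num [mul_comm]

theorem memLp_thetaCoeff (hU : MemLp U 2) (n : ℤ) : MemLp (thetaCoeff n U) 2 := by
  refine ⟨aestronglyMeasurable_thetaCoeff hU n, ?_⟩
  have hU2 := hU.2
  rw [eLpNorm_lt_top_iff_lintegral_rpow_enorm_lt_top (by norm_num) (by norm_num)] at hU2 ⊢
  simp only [ENNReal.toReal_ofNat] at hU2 ⊢
  have hm : AEStronglyMeasurable U ((volume : Measure ℂ).prod (volume : Measure S1)) := hU.1
  rw [Measure.volume_eq_prod, lintegral_prod _ (hm.enorm.pow_const _)] at hU2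
  calc ∫⁻ z, ‖thetaCoeff n U z‖ₑ ^ (2 : ℝ)
      ≤ ∫⁻ z, ENNReal.ofReal (2 * Real.pi) * ∫⁻ θ : S1, ‖U (z, θ)‖ₑ ^ (2 : ℝ) :=
        lintegral_mono_ae (hm.prodMk_left.mono fun z hz => enorm_thetaCoeff_sq_le n hz)
    _ = ENNReal.ofReal (2 * Real.pi) * ∫⁻ z, ∫⁻ θ : S1, ‖U (z, θ)‖ₑ ^ (2 : ℝ) :=
        lintegral_const_mul' _ _ ENNReal.ofReal_ne_top
    _ < ⊤ := ENNReal.mul_lt_top ENNReal.ofReal_lt_top hU2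

theorem integral_mul_prodTest (hU : MemLp U 2) {f : ℂ → ℂ} (hf : Continuous f)
    (hs : HasCompactSupport f) (n : ℤ) :
    ∫ p, U p * prodTest f n p = ∫ z, thetaCoeff n U z * f z := by
  have hc : Continuous (prodTest f n) :=
    (hf.comp continuous_fst).mul ((map_continuous (fourier n)).comp continuous_snd)
  have hint : Integrable (fun p => U p * prodTest f n p)
      ((volume : Measure ℂ).prod (volume : Measure S1)) :=
    integrable_mul_of_memLp_two hU
      (hc.memLp_of_hasCompactSupport (hasCompactSupport_prodTest hs))
  rw [Measure.volume_eq_prod, integral_prod _ hint]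
  refine integral_congr_ae (Eventually.of_forall fun z => ?_)
  simp only [thetaCoeff, prodTest]
  rw [← integral_mul_const]
  exact integral_congr_ae (Eventually.of_forall fun θ => by ring)

/-- There are countably many modes, so for almost every z all coefficients of the slice vanish at
once; the slice is then 0 by completeness, and Tonelli concludes. -/
theorem ae_eq_zero_of_thetaCoeff_ae_eq_zero (hU : MemLp U 2)
    (h : ∀ n, thetaCoeff n U =ᵐ[volume] 0) : U =ᵐ[volume] 0 := by
  have hm : AEStronglyMeasurable U ((volume : Measure ℂ).prod (volume : Measure S1)) := hU.1
  have hsq : Integrable (fun p => ‖U p‖ ^ 2) ((volume : Measure ℂ).prod (volume : Measure S1)) :=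
    (memLp_two_iff_integrable_sq_norm hm).1 hU
  have hz : ∀ᵐ z : ℂ, (fun θ : S1 => U (z, θ)) =ᵐ[volume] 0 := by
    filter_upwards [ae_all_iff.2 h, hm.prodMk_left, hsq.prod_right_ae] with z h1 h2 h3
    exact ae_eq_zero_of_fourier_integrals_eq_zero ((memLp_two_iff_integrable_sq_norm h2).2 h3) h1
  have hl : ∫⁻ p, ‖U p‖ₑ ∂((volume : Measure ℂ).prod (volume : Measure S1)) = 0 := by
    rw [lintegral_prod _ hm.enorm]
    rw [lintegral_congr_ae (g := fun _ => 0), lintegral_zero]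
    filter_upwards [hz] with z hz
    rw [lintegral_congr_ae (g := fun _ => 0), lintegral_zero]
    filter_upwards [hz] with θ hθ
    simp only [hθ, Pi.zero_apply, enorm_zero]
  rw [lintegral_eq_zero_iff' hm.enorm] at hl
  exact hl.mono fun p hp => by simpa using hp

/-- The weak form of the Dirac equation on `ℂ × S¹`. -/
def WeakDirac (U : Fin 2 → Space → ℂ) : Prop :=
  ∀ φ : Space → ℂ, IsSmooth φ → HasCompactSupport φ →
    1 / Complex.I * (∫ p, U 0 p * partialDeriv 2 φ p) + (∫ p, U 1 p * partialDeriv 0 φ p) +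
        Complex.I * (∫ p, U 1 p * partialDeriv 1 φ p) = 0 ∧
    (∫ p, U 0 p * partialDeriv 0 φ p) - Complex.I * (∫ p, U 0 p * partialDeriv 1 φ p) +
        1 / Complex.I * (∫ p, U 1 p * partialDeriv 2 φ p) = 0

/-- A square integrable weak solution of the Dirac equation on `ℂ × S¹` vanishes. -/
theorem WeakDirac.ae_eq_zero {U : Fin 2 → Space → ℂ} (h : WeakDirac U) (hU : ∀ i, MemLp (U i) 2)
    (i : Fin 2) : U i =ᵐ[volume] 0 := by
  have key : ∀ n, thetaCoeff n (U 0) =ᵐ[volume] 0 ∧ thetaCoeff n (U 1) =ᵐ[volume] 0 := by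
    intro n
    have hconv : ∀ (i : Fin 2) (j : Fin 3) {f : ℂ → ℂ}, ContDiff ℝ ∞ f → HasCompactSupport f →
        ∫ p, U i p * partialDeriv j (prodTest f n) p =
          ∫ z, thetaCoeff n (U i) z * slotDeriv j f n z := fun i j f hf hs => by
      rw [partialDeriv_prodTest hf]
      exact integral_mul_prodTest (hU i) (contDiff_slotDeriv hf j).continuous
        (hasCompactSupport_slotDeriv hs j) n
    -- Differentiating exp(inθ) gives the factor in, and (1/i)(in) = n.
    have htheta : ∀ (i : Fin 2) (f : ℂ → ℂ), 1 / Complex.I *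
        ∫ z, thetaCoeff n (U i) z * slotDeriv 2 f n z = ∫ z, n * thetaCoeff n (U i) z * f z := by
      intro i f
      rw [← integral_const_mul]
      refine integral_congr_ae (Eventually.of_forall fun z => ?_)
      simp only [slotDeriv, Matrix.cons_val]
      field_simp [Complex.I_ne_zero]
    refine ae_eq_zero_of_weak_dirac_mode (memLp_thetaCoeff (hU 0) n) (memLp_thetaCoeff (hU 1) n) n
      (fun f hf hs => ?_) (fun f hf hs => ?_)
    · have := (h _ (isSmooth_prodTest (n := n) hf) (hasCompactSupport_prodTest hs)).1
      rw [hconv _ _ hf hs, hconv _ _ hf hs, hconv _ _ hf hs, htheta, ← integral_const_mul] at this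
      simpa only [slotDeriv, Matrix.cons_val, mul_assoc] using this
    · have := (h _ (isSmooth_prodTest (n := n) hf) (hasCompactSupport_prodTest hs)).2
      rw [hconv _ _ hf hs, hconv _ _ hf hs, hconv _ _ hf hs, htheta, sub_eq_add_neg, ← neg_mul,
        ← integral_const_mul, add_comm, ← add_assoc] at this
      simpa only [slotDeriv, Matrix.cons_val, mul_assoc] using this
  refine ae_eq_zero_of_thetaCoeff_ae_eq_zero (hU i) fun n => ?_
  fin_cases i
  · exact (key n).1
  · exact (key n).2

end FourierCoefficients

/-! ### The glued function solves the Dirac equation on all of ℂ × S¹ -/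

section Gluing

/-- The factors 2 cancel the halves in ∂/∂z and ∂/∂z̄, and the second row changes sign. -/
theorem diracExpr_eq_zero_iff (W : Fin 2 → Fin 3 → Space → ℂ) (p : Space) :
    diracExpr W p = 0 ↔ 1 / Complex.I * W 0 2 p + W 1 0 p + Complex.I * W 1 1 p = 0 ∧
      W 0 0 p - Complex.I * W 0 1 p + 1 / Complex.I * W 1 2 p = 0 := by
  have h : diracExpr W p = 0 ↔ 1 / Complex.I * W 0 2 p + 2 * dzbar (W 1) p = 0 ∧
      -2 * dz (W 0) p - 1 / Complex.I * W 1 2 p = 0 := by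
    rw [← WithLp.ofLp_eq_zero 2]
    simp only [diracExpr]
    rw [funext_iff, Fin.forall_fin_two]
    simp
  rw [h, dz, dzbar]
  constructor <;> rintro ⟨h1, h2⟩ <;> constructor
  · linear_combination h1
  · linear_combination -h2
  · linear_combination h1
  · linear_combination -h2

/-- If `D` annihilates the field with gradients `W` on `Ω`, then so it does after integration
against a test function. -/
theorem integral_dirac_rows {Ω : Set Space} {W : Fin 2 → Fin 3 → Space → ℂ} {φ : Space → ℂ}
    (hi : ∀ i j, IntegrableOn (fun p => W i j p * φ p) Ω)
    (hD : ∀ᵐ p ∂(volume.restrict Ω), diracExpr W p = 0) :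
    1 / Complex.I * (∫ p in Ω, W 0 2 p * φ p) + (∫ p in Ω, W 1 0 p * φ p) +
        Complex.I * (∫ p in Ω, W 1 1 p * φ p) = 0 ∧
    (∫ p in Ω, W 0 0 p * φ p) - Complex.I * (∫ p in Ω, W 0 1 p * φ p) +
        1 / Complex.I * (∫ p in Ω, W 1 2 p * φ p) = 0 := by
  simp only [diracExpr_eq_zero_iff] at hD
  have hc := fun (c : ℂ) i j => Integrable.const_mul (hi i j) c
  have hl : Integrable (fun p => 1 / Complex.I * (W 0 2 p * φ p) + W 1 0 p * φ p)
      (volume.restrict Ω) := (hc _ 0 2).add (hi 1 0)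
  have hr : Integrable (fun p => W 0 0 p * φ p - Complex.I * (W 0 1 p * φ p))
      (volume.restrict Ω) := (hi 0 0).sub (hc _ 0 1)
  constructor
  · rw [← integral_const_mul, ← integral_const_mul, ← integral_add (hc _ 0 2) (hi 1 0),
      ← integral_add hl (hc _ 1 1)]
    refine integral_eq_zero_of_ae (hD.mono fun p hp => ?_)
    simp only [Pi.zero_apply]
    linear_combination φ p * hp.1
  · rw [← integral_const_mul, ← integral_const_mul, ← integral_sub (hi 0 0) (hc _ 0 1),
      ← integral_add hr (hc _ 1 2)]
    refine integral_eq_zero_of_ae (hD.mono fun p hp => ?_)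
    simp only [Pi.zero_apply]
    linear_combination φ p * hp.2

/-- The function which is `u` inside the solid torus and `u'` outside. -/
def glue (u u' : Space → ℂ) : Space → ℂ :=
  fun p => openSolidTorus.indicator u p + exterior.indicator u' p

variable {u u' : Space → ℂ}

theorem memLp_glue (hu : MemLp u 2 (volume.restrict openSolidTorus))
    (hu' : MemLp u' 2 (volume.restrict exterior)) : MemLp (glue u u') 2 :=
  ((memLp_indicator_iff_restrict isOpen_openSolidTorus.measurableSet).2 hu).add
    ((memLp_indicator_iff_restrict isOpen_exterior.measurableSet).2 hu')

theorem integral_glue_mul (hu : MemLp u 2 (volume.restrict openSolidTorus))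
    (hu' : MemLp u' 2 (volume.restrict exterior)) {ψ : Space → ℂ} (hψ : Continuous ψ)
    (hs : HasCompactSupport ψ) :
    ∫ p, glue u u' p * ψ p = (∫ p in openSolidTorus, u p * ψ p) + ∫ p in exterior, u' p * ψ p := by
  rw [← integral_indicator isOpen_openSolidTorus.measurableSet,
    ← integral_indicator isOpen_exterior.measurableSet, ← integral_add]
  · refine integral_congr_ae (Eventually.of_forall fun p => ?_)
    simp only [glue, add_mul, Set.indicator_mul_left]
  · exact (integrable_indicator_iff isOpen_openSolidTorus.measurableSet).2
      (hu.integrable_mul (memLp_of_continuous_hasCompactSupport hψ hs _))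
  · exact (integrable_indicator_iff isOpen_exterior.measurableSet).2
      (hu'.integrable_mul (memLp_of_continuous_hasCompactSupport hψ hs _))

theorem memLp_component {Ω : Set Space} {F : Space → C2} (hF : MemLp F 2 (volume.restrict Ω))
    (i : Fin 2) : MemLp (fun p => F p i) 2 (volume.restrict Ω) :=
  (EuclideanSpace.proj (𝕜 := ℂ) i : C2 →L[ℂ] ℂ).comp_memLp' hF

/-- Gluing moves every derivative from φ back onto the gradients inside and outside, where D
annihilates them pointwise almost everywhere. -/
theorem weakDirac_glue {F Fext : Space → C2} {W : Fin 2 → Fin 3 → Space → ℂ}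
    (hW : ∀ i, HasH1Gradient openSolidTorus (fun p => F p i) (W i))
    (hD : ∀ᵐ p ∂(volume.restrict openSolidTorus), diracExpr W p = 0)
    (hext : IsAdmissibleExtension F Fext) :
    WeakDirac fun i => glue (fun p => F p i) fun p => Fext p i := by
  obtain ⟨⟨W', hW', hD'⟩, htrace, hL2⟩ := hext
  intro φ hφ hs
  have hglue : ∀ i j, ∫ p, glue (fun p => F p i) (fun p => Fext p i) p * partialDeriv j φ p =
      -((∫ p in openSolidTorus, W i j p * φ p) + ∫ p in exterior, W' i j p * φ p) := by
    intro i j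
    obtain ⟨g, hg, hg'⟩ := htrace i
    rw [integral_glue_mul (hW i).1 (memLp_component hL2 i) (hφ.continuous_partialDeriv j)
      (hasCompactSupport_partialDeriv hs j)]
    exact glue_weak_derivatives (hW i) (hW' i) hg hg' j hφ hs
  obtain ⟨a1, a2⟩ := integral_dirac_rows (φ := φ) (fun i j => ((hW i).2 j).1.integrable_mul
    (memLp_of_continuous_hasCompactSupport hφ.continuous hs _)) hD
  obtain ⟨b1, b2⟩ := integral_dirac_rows (φ := φ)
    (fun i j => (hW' i).integrableOn_exterior_gradient_mul j hφ.continuous hs) hD'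
  simp only [hglue]
  constructor
  · linear_combination -a1 - b1
  · linear_combination -a2 - b2

theorem restrict_solidTorus_eq :
    (volume : Measure Space).restrict solidTorus = volume.restrict openSolidTorus := by
  refine Measure.restrict_congr_set ?_
  filter_upwards [ae_norm_ne_one] with p hp
  exact propext ⟨fun h => lt_of_le_of_ne h hp, fun h => openSolidTorus_subset h⟩

theorem hasH1Gradient_zero {Ω : Set Space} {u : Space → ℂ} (hu : u =ᵐ[volume.restrict Ω] 0) :
    HasH1Gradient Ω u 0 := by
  refine ⟨MemLp.zero.ae_eq hu.symm, fun j => ⟨MemLp.zero, fun φ _ _ _ => ?_⟩⟩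
  rw [integral_eq_zero_of_ae (hu.mono fun p hp => by simp [hp])]
  simp

theorem partialDeriv_zero_fun (j : Fin 3) : partialDeriv j 0 = 0 := by
  funext p
  simp [partialDeriv]

theorem hasTrace_zero {Ω : Set Space} {u : Space → ℂ} (hu : u =ᵐ[volume.restrict Ω] 0) :
    HasTrace Ω u 0 := by
  refine ⟨MemLp.zero, 0, hasH1Gradient_zero hu, fun _ => 0, fun _ => contDiff_const, ?_, ?_, ?_⟩
  · refine tendsto_const_nhds.congr fun _ => ?_
    rw [eLpNorm_congr_ae (g := 0) (hu.mono fun p hp => by simp [hp]), eLpNorm_zero]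
  · intro j
    simp [partialDeriv_zero_fun]
  · simp

/-- The extension is 0. The chosen representative of the zero class is only known to vanish almost
everywhere, so the traces and gradients are taken for functions vanishing almost everywhere. -/
theorem zero_mem_diracKernel : (0 : Hilb) ∈ diracKernel := by
  have h0 : ∀ᵐ p ∂(volume.restrict openSolidTorus), (0 : Hilb) p = 0 := by
    rw [← restrict_solidTorus_eq]
    exact Lp.coeFn_zero _ _ _
  have hi : ∀ i, (fun p => (0 : Hilb) p i) =ᵐ[volume.restrict openSolidTorus] 0 := fun i =>
    h0.mono fun p hp => by
      change (0 : Hilb) p i = 0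
      rw [hp]
      rfl
  have hz : ∀ p, diracExpr 0 p = 0 := fun p => by simp [diracExpr_eq_zero_iff]
  have hext : ∀ (Ω : Set Space) (i : Fin 2),
      (fun p => (0 : Space → C2) p i) =ᵐ[volume.restrict Ω] 0 := fun Ω i =>
    Eventually.of_forall fun p => rfl
  refine ⟨⟨fun i => ⟨0, hasH1Gradient_zero (hi i)⟩, 0, ⟨0, fun i R _ => ?_, ?_⟩, fun i => ?_, ?_⟩,
    0, fun i => hasH1Gradient_zero (hi i), ?_⟩
  · exact hasH1Gradient_zero (hext _ i)
  · exact Eventually.of_forall hz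
  · exact ⟨0, hasTrace_zero (hi i), hasTrace_zero (hext _ i)⟩
  · exact MemLp.zero
  · exact h0.mono fun p hp => hp.trans (hz p).symm

end Gluing

end SolidTorusDirac
end

open SolidTorusDirac in
theorem mainTheorem5 : SolidTorusDirac.diracKernel = {0} := by
  refine Set.eq_singleton_iff_unique_mem.2 ⟨zero_mem_diracKernel, fun F hF => ?_⟩
  obtain ⟨⟨-, Fext, hext⟩, W, hW, hD⟩ := hF
  have h0 : ∀ᵐ p ∂(volume.restrict openSolidTorus), (0 : Hilb) p = 0 := by
    rw [← restrict_solidTorus_eq]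
    exact Lp.coeFn_zero _ _ _
  have hD0 : ∀ᵐ p ∂(volume.restrict openSolidTorus), diracExpr W p = 0 := by
    filter_upwards [hD, h0] with p h1 h2
    exact h1.symm.trans h2
  have hU := (weakDirac_glue hW hD0 hext).ae_eq_zero
    fun i => memLp_glue (hW i).1 (memLp_component hext.2.2 i)
  have hF0 : ∀ᵐ p ∂(volume.restrict openSolidTorus), F p = 0 := by
    refine (ae_restrict_iff' isOpen_openSolidTorus.measurableSet).2 ?_
    filter_upwards [hU 0, hU 1] with p h1 h2 hp
    have hp' : p ∉ exterior := fun h => lt_asymm (α := ℝ) h hp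
    simp only [glue, Set.indicator_of_mem hp, Set.indicator_of_notMem hp', add_zero] at h1 h2
    ext i
    fin_cases i
    · exact h1
    · exact h2
  -- The boundary torus is a null set, so vanishing on the open solid torus determines the class in
  -- `Hilb`.
  rw [← restrict_solidTorus_eq] at hF0
  exact Lp.eq_zero_iff_ae_eq_zero.2 hF0
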